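/- For a bounded function $u:\mathbb R\to\mathbb C$, let $$(-\Delta)^{1/2}u(x)=\frac1\pi\,\mathrm{p.v.}\!\int_{-\infty}^{\infty}\frac{u(x)-u(x+y)}{|y|^{2}}\,dy$$ denote the half Laplacian, that is, the case $\alpha=1$ of $(-\Delta)^{\alpha/2}u(x)=c_\alpha\,\mathrm{p.v.}\!\int_{-\infty}^\infty\frac{u(x)-u(x+y)}{|y|^{1+\alpha}}dy$ with $c_\alpha=\alpha\frac{2^{\alpha-1}\Gamma(1/2+\alpha/2)}{\sqrt\pi\,\Gamma(1-\alpha/2)}$. Let $\operatorname{acot}:\mathbb R\to(0,\pi)$ be the inverse cotangent, and let ${}_2F_1(a,b;c;z)=\sum_{n=0}^\infty\frac{(a)_n(b)_n}{(c)_n}\frac{z^n}{n!}$ be the Gaussian hypergeometric series. Let $k$ be an odd integer, $L>0$, $s\in(0,\pi)$, and $x=L\cot(s)\Longleftrightarrow s=\operatorname{acot}(x/L)$. Then the half Laplacian of the function $y\mapsto e^{ik\operatorname{acot}(y/L)}$ exists at the point $x$ and equals $$-\frac{2i}{L\pi(k+2)}-\frac kL\sin^2(s)e^{iks}+\frac{8i\,{}_2F_1(1,-k/2-1;-k/2+2;e^{2is})}{L\pi(4-k^2)},$$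 where the hypergeometric series converges absolutely, and it also equals $$-\frac{2i\,\operatorname{sgn}(k)}{L\pi(|k|+2)}-\frac{2ik}{L\pi}e^{iks}\left[\cos(s)+\sin^2(s)\ln\left(\cot\left(\frac s2\right)\right)+\sum_{n=0}^{(|k|-1)/2}\frac{4e^{-i\operatorname{sgn}(k)(2n+1)s}}{(2n-1)(2n+1)(2n+3)}\right].$$ Furthermore, when $L=1$, both forms are expressed in terms of $x$ as follows: for every $x\in\mathbb R$, the half Laplacian of $y\mapsto\frac{(y+i)^k}{(y^2+1)^{k/2}}$ exists at $x$ and equals $$-\frac{2i}{\pi(k+2)}-\frac{k(x+i)^k}{(x^2+1)^{k/2+1}}+\frac{8i}{\pi(4-k^2)}\,{}_2F_1\left(1,-\frac k2-1;-\frac k2+2;\frac{(x+i)^2}{x^2+1}\right)$$ (again with an absolutely convergent series), and it also equals $$-\frac{2i\,\operatorname{sgn}(k)}{\pi(|k|+2)}-\frac{2ik(x+i)^k\left[x(x^2+1)^{1/2}+\operatorname{arsinh}(x)\right]}{\pi(x^2+1)^{k/2+1}}-\sum_{n=0}^{(|k|-1)/2}\frac{8ik(x+i)^{k-\operatorname{sgn}(k)(2n+1)}}{\pi(2n-1)(2n+1)(2n+3)(x^2+1)^{[k-\operatorname{sgn}(k)(2n+1)]/2}}.$$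 -/

import Mathlib

open Filter Topology MeasureTheory

namespace HalfLap

noncomputable section

/-- The inverse cotangent with values in `(0, π)`. -/
def acot (t : ℝ) : ℝ := Real.pi / 2 - Real.arctan t

/-- The normalizing constant `c_α` of the fractional Laplacian `(-Δ)^{α/2}` on the real line. -/
def fracLapConst (α : ℝ) : ℝ :=
  α * ((2 : ℝ) ^ (α - 1) * Real.Gamma (1 / 2 + α / 2)) /
    (Real.sqrt Real.pi * Real.Gamma (1 - α / 2))

/-- The integrand `(u(x) - u(x+y)) / |y|^{1+α}`. -/
def fracLapIntegrand (α : ℝ) (u : ℝ → ℂ) (x y : ℝ) : ℂ :=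
  (u x - u (x + y)) / ((|y| ^ (1 + α) : ℝ) : ℂ)

/-- `HasFracLaplacianAt α u x v`: the fractional Laplacian `(-Δ)^{α/2} u` exists at `x`, as the
principal value integral `c_α · p.v. ∫ (u(x) - u(x+y)) / |y|^{1+α} dy`, and equals `v`. -/
def HasFracLaplacianAt (α : ℝ) (u : ℝ → ℂ) (x : ℝ) (v : ℂ) : Prop :=
  (∀ ε : ℝ, 0 < ε → IntegrableOn (fracLapIntegrand α u x) {y : ℝ | ε < |y|}) ∧
  Tendsto
    (fun ε : ℝ => (fracLapConst α : ℂ) * ∫ y in {y : ℝ | ε < |y|}, fracLapIntegrand α u x y)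
    (𝓝[>] 0) (𝓝 v)

/-- The half Laplacian `(-Δ)^{1/2} u` exists at `x` and equals `v`. -/
def HasHalfLaplacianAt (u : ℝ → ℂ) (x : ℝ) (v : ℂ) : Prop :=
  HasFracLaplacianAt 1 u x v

/-- The `n`-th term of the Gaussian hypergeometric series `₂F₁(1, -k/2-1; -k/2+2; z)`. -/
def hypTerm (k : ℤ) (z : ℂ) (n : ℕ) : ℂ :=
  ordinaryHypergeometricSeries ℂ (1 : ℂ) (-(k : ℂ) / 2 - 1) (-(k : ℂ) / 2 + 2) n (fun _ => z)

end

end HalfLap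

/-! Put `s = acot x` and `δ = acot (x + y) - s`. After scaling to `L = 1` and factoring out
`e^{iks}`, everything reduces to `W k = p.v. ∫ (1 - e^{ikδ}) / y² dy`. The addition formula gives
`sin² δ = y² / ((1 + x²)(1 + (x + y)²))`, so the second difference of the integrand in `k` with step
2, which produces `4 e^{ikδ} sin² δ / y²`, loses its singularity and becomes a constant times
`e^{ikδ} / (1 + (x + y)²)`. Since `dδ/dy = -1 / (1 + (x + y)²)`, that integral is elementary
(`phaseIntegrand_second_difference`, `hasPV_exp_div`).

Thus `W` on odd integers is determined by a second-order recurrence and its values at `k = ±1`,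
where `tan (δ/2)` and `log |tan (δ/2)|` give an explicit antiderivative
(`hasPV_phaseIntegrand_base`).

It remains to check that the claimed value satisfies the same recurrence and initial conditions. The
Pochhammer quotient collapses, so the hypergeometric series is a multiple of `∑ e^{ijs} / ((j-2) j
(j+2))` over `j = -k, -k+2, …` (`hypTerm_eq`). Moving `k` by 2 adds or removes one term, which gives
the recurrence (`phaseValue_recurrence`). The sum starting at `j = 1` follows from partial
fractions, the artanh series and an Abel limit (`oddSum_neg_one`). The finitely many other terms
then yield the closed form (`phaseValue_eq_closed_form`). -/

namespace HalfLap

/-! ### Principal values: linearity, scaling, fundamental theorem of calculus -/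

/-- `HasPV f v`: the function `f` is integrable away from `0`, and `v` is the principal value at `0`
of its integral over the real line. -/
def HasPV (f : ℝ → ℂ) (v : ℂ) : Prop :=
  (∀ ε : ℝ, 0 < ε → IntegrableOn f {y : ℝ | ε < |y|}) ∧
  Tendsto (fun ε : ℝ => ∫ y in {y : ℝ | ε < |y|}, f y) (𝓝[>] 0) (𝓝 v)

theorem HasPV.add {f g : ℝ → ℂ} {v w : ℂ} (hf : HasPV f v) (hg : HasPV g w) :
    HasPV (fun y => f y + g y) (v + w) := by
  refine ⟨fun ε hε => (hf.1 ε hε).add (hg.1 ε hε), (hf.2.add hg.2).congr' ?_⟩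
  filter_upwards [self_mem_nhdsWithin] with ε hε
  exact (integral_add (hf.1 ε hε) (hg.1 ε hε)).symm

theorem HasPV.const_mul {f : ℝ → ℂ} {v : ℂ} (c : ℂ) (hf : HasPV f v) :
    HasPV (fun y => c * f y) (c * v) := by
  refine ⟨fun ε hε => (hf.1 ε hε).const_mul c, (hf.2.const_mul c).congr fun ε => ?_⟩
  exact (integral_const_mul c f).symm

theorem HasPV.congr {f g : ℝ → ℂ} {v w : ℂ} (hf : HasPV f v) (h : ∀ y, y ≠ 0 → f y = g y)
    (hvw : v = w) : HasPV g w := by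
  subst hvw
  have hm : ∀ ε : ℝ, MeasurableSet {y : ℝ | ε < |y|} := fun ε =>
    measurableSet_lt measurable_const measurable_norm
  have he : ∀ ε : ℝ, 0 < ε → Set.EqOn f g {y : ℝ | ε < |y|} := fun ε hε y hy =>
    h y (abs_pos.1 (hε.trans hy))
  refine ⟨fun ε hε => (hf.1 ε hε).congr_fun (he ε hε) (hm ε), hf.2.congr' ?_⟩
  filter_upwards [self_mem_nhdsWithin] with ε hε
  exact setIntegral_congr_fun (hm ε) (he ε hε)

theorem HasPV.comp_div {f : ℝ → ℂ} {v : ℂ} (hf : HasPV f v) {L : ℝ} (hL : 0 < L) :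
    HasPV (fun y => f (y / L)) (L * v) := by
  have hset : ∀ ε : ℝ, (fun y : ℝ => y / L) ⁻¹' {y : ℝ | ε / L < |y|} = {y : ℝ | ε < |y|} := by
    intro ε
    ext y
    simp only [Set.mem_preimage, Set.mem_ofPred_eq, abs_div, abs_of_pos hL]
    exact div_lt_div_iff_of_pos_right hL
  have hm : ∀ ε : ℝ, MeasurableSet {y : ℝ | ε < |y|} := fun ε =>
    measurableSet_lt measurable_const measurable_norm
  have hind : ∀ ε : ℝ, {y : ℝ | ε < |y|}.indicator (fun y => f (y / L)) =
      fun y => ({y : ℝ | ε / L < |y|}.indicator f) (y / L) := by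
    intro ε
    rw [← hset ε]
    rfl
  constructor
  · intro ε hε
    rw [← integrable_indicator_iff (hm ε), hind]
    exact ((integrable_indicator_iff (hm _)).2 (hf.1 (ε / L) (div_pos hε hL))).comp_div hL.ne'
  · have ht : Tendsto (fun ε : ℝ => ε / L) (𝓝[>] 0) (𝓝[>] 0) := by
      refine tendsto_nhdsWithin_iff.2 ⟨?_, ?_⟩
      · have : Tendsto (fun ε : ℝ => ε / L) (𝓝 0) (𝓝 (0 / L)) := tendsto_id.div_const L
        rw [zero_div] at this
        exact this.mono_left nhdsWithin_le_nhds
      · filter_upwards [self_mem_nhdsWithin] with ε hε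
        exact div_pos hε hL
    refine ((hf.2.comp ht).const_mul (L : ℂ)).congr fun ε => ?_
    rw [Function.comp_apply, ← integral_indicator (hm ε), hind, ← integral_indicator (hm _),
      Measure.integral_comp_div, abs_of_pos hL, Complex.real_smul]

theorem integrableOn_of_norm_le_div_sq {f : ℝ → ℂ} {C : ℝ} (hm : AEStronglyMeasurable f)
    (hb : ∀ y, y ≠ 0 → ‖f y‖ ≤ C / y ^ 2) {ε : ℝ} (hε : 0 < ε) :
    IntegrableOn f {y : ℝ | ε < |y|} := by
  have hset : {y : ℝ | ε < |y|} = Set.Iio (-ε) ∪ Set.Ioi ε := by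
    ext y
    simp only [Set.mem_ofPred_eq, lt_abs, Set.mem_union, Set.mem_Iio, Set.mem_Ioi]
    constructor <;> rintro (h | h) <;> first | (left; linarith) | (right; linarith)
  have h1 : IntegrableOn (fun y : ℝ => C / y ^ 2) (Set.Ioi ε) := by
    have := (integrableOn_Ioi_rpow_of_lt (by norm_num : (-2 : ℝ) < -1) hε).const_mul C
    refine IntegrableOn.congr_fun this (fun y hy => ?_) measurableSet_Ioi
    have hy' : 0 < y := hε.trans hy
    rw [Real.rpow_neg hy'.le, div_eq_mul_inv]
    norm_cast
  have h2 : IntegrableOn (fun y : ℝ => C / y ^ 2) (Set.Iio (-ε)) := by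
    have := (integrable_indicator_iff measurableSet_Ioi).2 h1
    rw [← integrable_indicator_iff measurableSet_Iio]
    refine this.comp_neg.congr (ae_of_all _ fun y => ?_)
    simp only [Set.indicator, Set.mem_Iio, Set.mem_Ioi, lt_neg, neg_sq]
  have h3 : IntegrableOn (fun y : ℝ => C / y ^ 2) {y : ℝ | ε < |y|} := hset ▸ h2.union h1
  refine Integrable.mono' h3 hm.restrict ?_
  filter_upwards [ae_restrict_mem (measurableSet_lt measurable_const measurable_norm)] with y hy
  exact hb y (abs_pos.1 (hε.trans hy))

/-- The antiderivative may blow up at 0: only the symmetric difference `F (-ε) - F ε` has to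
converge, which is what lets logarithmic singularities cancel. -/
theorem HasPV.of_hasDerivAt {f F : ℝ → ℂ} {a b c : ℂ}
    (hint : ∀ ε : ℝ, 0 < ε → IntegrableOn f {y : ℝ | ε < |y|})
    (hF : ∀ y, y ≠ 0 → HasDerivAt F (f y) y)
    (hbot : Tendsto F atBot (𝓝 a)) (htop : Tendsto F atTop (𝓝 b))
    (hzero : Tendsto (fun ε => F (-ε) - F ε) (𝓝[>] 0) (𝓝 c)) :
    HasPV f (b - a + c) := by
  refine ⟨hint, (hzero.const_add (b - a)).congr' ?_⟩
  filter_upwards [self_mem_nhdsWithin] with ε hε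
  have hε : 0 < ε := hε
  have hset : {y : ℝ | ε < |y|} = Set.Iio (-ε) ∪ Set.Ioi ε := by
    ext y
    simp only [Set.mem_ofPred_eq, lt_abs, Set.mem_union, Set.mem_Iio, Set.mem_Ioi]
    constructor <;> rintro (h | h) <;> first | (left; linarith) | (right; linarith)
  have hi := hint ε hε
  rw [hset] at hi ⊢
  have hd : Disjoint (Set.Iio (-ε)) (Set.Ioi ε) := by
    rw [Set.disjoint_left]
    intro y h1 h2
    simp only [Set.mem_Iio, Set.mem_Ioi] at h1 h2
    linarith
  rw [setIntegral_union hd measurableSet_Ioi hi.left_of_union hi.right_of_union,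
    integral_Ioi_of_hasDerivAt_of_tendsto (hF ε hε.ne').continuousAt.continuousWithinAt
      (fun y hy => hF y (hε.trans hy).ne') hi.right_of_union htop,
    ← integral_Iic_eq_integral_Iio,
    integral_Iic_of_hasDerivAt_of_tendsto (hF (-ε) (by linarith)).continuousAt.continuousWithinAt
      (fun y hy => hF y (by have : y < -ε := hy; linarith))
      (integrableOn_Iic_iff_integrableOn_Iio (by finiteness) |>.2 hi.left_of_union) hbot]
  ring

/-! ### The inverse cotangent -/

theorem sin_acot (x : ℝ) : Real.sin (acot x) = 1 / √(1 + x ^ 2) := by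
  rw [acot, Real.sin_pi_div_two_sub, Real.cos_arctan]

theorem cos_acot (x : ℝ) : Real.cos (acot x) = x / √(1 + x ^ 2) := by
  rw [acot, Real.cos_pi_div_two_sub, Real.sin_arctan]

theorem acot_pos (x : ℝ) : 0 < acot x := by
  have := Real.arctan_lt_pi_div_two x
  rw [acot]; linarith

theorem acot_lt_pi (x : ℝ) : acot x < Real.pi := by
  have := Real.neg_pi_div_two_lt_arctan x
  rw [acot]; linarith

theorem sin_acot_sq (x : ℝ) : Real.sin (acot x) ^ 2 = 1 / (1 + x ^ 2) := by
  rw [sin_acot, div_pow, Real.sq_sqrt (by positivity), one_pow]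

theorem cot_acot (x : ℝ) : Real.cot (acot x) = x := by
  have h : √(1 + x ^ 2) ≠ 0 := by positivity
  rw [Real.cot_eq_cos_div_sin, sin_acot, cos_acot]
  field_simp

theorem acot_cot {s : ℝ} (hs : s ∈ Set.Ioo 0 Real.pi) : acot (Real.cot s) = s := by
  have h : Real.cot s = Real.tan (Real.pi / 2 - s) := by
    rw [Real.tan_pi_div_two_sub, Real.tan_eq_sin_div_cos, inv_div, Real.cot_eq_cos_div_sin]
  rw [acot, h, Real.arctan_tan] <;> linarith [hs.1, hs.2]

theorem hasDerivAt_acot (x : ℝ) : HasDerivAt acot (-(1 / (1 + x ^ 2))) x :=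
  (Real.hasDerivAt_arctan x).const_sub _

theorem continuous_acot : Continuous acot := continuous_const.sub Real.continuous_arctan

theorem tendsto_acot_atTop : Tendsto acot atTop (𝓝 0) := by
  have := (Real.tendsto_arctan_atTop.mono_right nhdsWithin_le_nhds).const_sub (Real.pi / 2)
  rwa [sub_self] at this

theorem tendsto_acot_atBot : Tendsto acot atBot (𝓝 Real.pi) := by
  have := (Real.tendsto_arctan_atBot.mono_right nhdsWithin_le_nhds).const_sub (Real.pi / 2)
  rwa [sub_neg_eq_add, add_halves] at this

/-! ### The angle increment -/

/-- The increment of the inverse cotangent from `x` to `x + y`. -/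
noncomputable def acotDiff (x y : ℝ) : ℝ := acot (x + y) - acot x

theorem continuous_acotDiff (x : ℝ) : Continuous (acotDiff x) :=
  (continuous_acot.comp (continuous_const.add continuous_id)).sub continuous_const

theorem hasDerivAt_acotDiff (x y : ℝ) :
    HasDerivAt (acotDiff x) (-(1 / (1 + (x + y) ^ 2))) y := by
  have h := (hasDerivAt_acot (x + y)).comp_const_add x y
  exact h.sub_const _

theorem tendsto_acotDiff_atTop (x : ℝ) : Tendsto (acotDiff x) atTop (𝓝 (-acot x)) := by
  have := (tendsto_acot_atTop.comp (tendsto_atTop_add_const_left atTop x tendsto_id)).sub_const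
    (acot x)
  rwa [zero_sub] at this

theorem tendsto_acotDiff_atBot (x : ℝ) : Tendsto (acotDiff x) atBot (𝓝 (Real.pi - acot x)) :=
  (tendsto_acot_atBot.comp (tendsto_atBot_add_const_left atBot x tendsto_id)).sub_const (acot x)

theorem acotDiff_zero (x : ℝ) : acotDiff x 0 = 0 := by simp [acotDiff]

theorem sin_acotDiff (x y : ℝ) :
    Real.sin (acotDiff x y) = -y / (√(1 + x ^ 2) * √(1 + (x + y) ^ 2)) := by
  have h1 : √(1 + x ^ 2) ≠ 0 := by positivity
  have h2 : √(1 + (x + y) ^ 2) ≠ 0 := by positivity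
  rw [acotDiff, Real.sin_sub, sin_acot, sin_acot, cos_acot, cos_acot]
  field_simp
  ring

/-- The identity that trades the singular weight `1 / y²` for `1 / sin² δ`; both the antiderivative
at `k = ±1` and the recurrence rest on it. -/
theorem sin_acotDiff_sq (x y : ℝ) :
    Real.sin (acotDiff x y) ^ 2 = y ^ 2 / ((1 + x ^ 2) * (1 + (x + y) ^ 2)) := by
  rw [sin_acotDiff, div_pow, mul_pow, Real.sq_sqrt (by positivity), Real.sq_sqrt (by positivity),
    neg_sq]

/-- Both angles lie in `(0, π)`, so `|δ| < π` and `tan (δ/2)` has no pole on the whole line. -/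
theorem cos_half_acotDiff_pos (x y : ℝ) : 0 < Real.cos (acotDiff x y / 2) := by
  have := acot_pos x
  have := acot_pos (x + y)
  have := acot_lt_pi x
  have := acot_lt_pi (x + y)
  apply Real.cos_pos_of_mem_Ioo
  constructor <;> rw [acotDiff] <;> linarith

theorem sin_half_acotDiff_ne_zero (x : ℝ) {y : ℝ} (hy : y ≠ 0) :
    Real.sin (acotDiff x y / 2) ≠ 0 := by
  intro h
  have h1 : Real.sin (acotDiff x y) = 0 := by
    rw [show acotDiff x y = 2 * (acotDiff x y / 2) by ring, Real.sin_two_mul, h]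
    simp
  have h2 := sin_acotDiff_sq x y
  rw [h1] at h2
  have : 0 < y ^ 2 / ((1 + x ^ 2) * (1 + (x + y) ^ 2)) := by positivity
  linarith [h2]

/-! ### The principal value for frequencies `±1` -/

/-- The normalized half Laplacian integrand at `x` of the function `y ↦ exp (i k acot y)`. -/
noncomputable def phaseIntegrand (k : ℂ) (x y : ℝ) : ℂ :=
  (1 - Complex.exp (Complex.I * k * acotDiff x y)) / ((y ^ 2 : ℝ) : ℂ)

theorem norm_exp_I_mul_int_mul (k : ℤ) (t : ℝ) :
    ‖Complex.exp (Complex.I * (k : ℂ) * t)‖ = 1 := by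
  have : Complex.I * (k : ℂ) * t = ((k * t : ℝ) : ℂ) * Complex.I := by push_cast; ring
  rw [this, Complex.norm_exp_ofReal_mul_I]

theorem measurable_phaseIntegrand (k : ℂ) (x : ℝ) : Measurable (phaseIntegrand k x) := by
  have h := (continuous_acotDiff x).measurable
  unfold phaseIntegrand
  fun_prop

theorem norm_phaseIntegrand_le (k : ℤ) (x y : ℝ) : ‖phaseIntegrand k x y‖ ≤ 2 / y ^ 2 := by
  rw [phaseIntegrand, norm_div, Complex.norm_real, Real.norm_of_nonneg (sq_nonneg y)]
  gcongr
  calc _ ≤ ‖(1 : ℂ)‖ + ‖Complex.exp (Complex.I * (k : ℂ) * acotDiff x y)‖ := norm_sub_le _ _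
    _ = 2 := by rw [norm_exp_I_mul_int_mul, norm_one]; norm_num

theorem integrableOn_phaseIntegrand (k : ℤ) (x : ℝ) {ε : ℝ} (hε : 0 < ε) :
    IntegrableOn (phaseIntegrand k x) {y : ℝ | ε < |y|} :=
  integrableOn_of_norm_le_div_sq (measurable_phaseIntegrand k x).aestronglyMeasurable
    (fun y _ => norm_phaseIntegrand_le k x y) hε

theorem hasDerivAt_tan_half_acotDiff (x y : ℝ) :
    HasDerivAt (fun y => Real.tan (acotDiff x y / 2))
      (-(1 / (1 + (x + y) ^ 2)) / (2 * Real.cos (acotDiff x y / 2) ^ 2)) y := by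
  have h := (Real.hasDerivAt_tan (cos_half_acotDiff_pos x y).ne').comp y
    ((hasDerivAt_acotDiff x y).div_const 2)
  refine h.congr_deriv ?_
  have := (cos_half_acotDiff_pos x y).ne'
  field_simp

theorem tan_half_acotDiff_ne_zero (x : ℝ) {y : ℝ} (hy : y ≠ 0) :
    Real.tan (acotDiff x y / 2) ≠ 0 := by
  rw [Real.tan_eq_sin_div_cos]
  exact div_ne_zero (sin_half_acotDiff_ne_zero x hy) (cos_half_acotDiff_pos x y).ne'

theorem hasDerivAt_log_tan_half_acotDiff (x : ℝ) {y : ℝ} (hy : y ≠ 0) :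
    HasDerivAt (fun y => Real.log (Real.tan (acotDiff x y / 2)))
      (-(1 / (1 + (x + y) ^ 2)) / Real.sin (acotDiff x y)) y := by
  refine ((hasDerivAt_tan_half_acotDiff x y).log (tan_half_acotDiff_ne_zero x hy)).congr_deriv ?_
  have h1 := (cos_half_acotDiff_pos x y).ne'
  have h2 := sin_half_acotDiff_ne_zero x hy
  rw [show Real.sin (acotDiff x y) = 2 * Real.sin (acotDiff x y / 2) * Real.cos (acotDiff x y / 2)
    by rw [← Real.sin_two_mul]; ring_nf, Real.tan_eq_sin_div_cos]
  field_simp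

/-- The antiderivative of `phaseIntegrand σ x` for `σ = ±1`. -/
noncomputable def basePrimitive (σ : ℂ) (x y : ℝ) : ℂ :=
  -(1 / (1 + (x : ℂ) ^ 2)) * ((Real.tan (acotDiff x y / 2) : ℂ) -
    Complex.I * σ * (Real.log (Real.tan (acotDiff x y / 2)) : ℂ))

theorem one_add_sq_ne_zero (x : ℝ) : (1 + (x : ℂ) ^ 2) ≠ 0 := by
  have : (1 + x ^ 2 : ℝ) ≠ 0 := by positivity
  exact_mod_cast this

theorem exp_I_mul_eq_of_sq_eq_one {σ : ℂ} (hσ : σ = 1 ∨ σ = -1) (t : ℝ) :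
    Complex.exp (Complex.I * σ * t) = (Real.cos t : ℂ) + Complex.I * σ * (Real.sin t : ℂ) := by
  rw [show Complex.I * σ * t = (σ * t) * Complex.I by ring, Complex.exp_mul_I]
  rcases hσ with rfl | rfl
  · push_cast; simp; ring
  · push_cast; simp; ring

/-- In the variable `δ` the integrand is a constant times `(1 - cos δ - iσ sin δ) / sin² δ`, which
integrates to `tan (δ/2) - iσ log |tan (δ/2)|`. Because `Real.log` ignores signs, one formula serves
both sides of 0. -/
theorem hasDerivAt_basePrimitive {σ : ℂ} (hσ : σ = 1 ∨ σ = -1) (x : ℝ) {y : ℝ} (hy : y ≠ 0) :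
    HasDerivAt (basePrimitive σ x) (phaseIntegrand σ x y) y := by
  have h1 := (hasDerivAt_tan_half_acotDiff x y).ofReal_comp
  have h2 := (hasDerivAt_log_tan_half_acotDiff x hy).ofReal_comp
  refine ((h1.sub (h2.const_mul (Complex.I * σ))).const_mul
    (-(1 / (1 + (x : ℂ) ^ 2)))).congr_deriv ?_
  have hc := (cos_half_acotDiff_pos x y).ne'
  have hs := sin_half_acotDiff_ne_zero x hy
  have e1 : Real.sin (acotDiff x y) =
      2 * Real.sin (acotDiff x y / 2) * Real.cos (acotDiff x y / 2) := by
    rw [← Real.sin_two_mul]; ring_nf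
  have e2 : Real.cos (acotDiff x y) = 1 - 2 * Real.sin (acotDiff x y / 2) ^ 2 := by
    rw [← Real.cos_two_mul_eq_one_sub]; ring_nf
  have e3 : y ^ 2 = (2 * Real.sin (acotDiff x y / 2) * Real.cos (acotDiff x y / 2)) ^ 2 *
      ((1 + x ^ 2) * (1 + (x + y) ^ 2)) := by
    rw [← e1, sin_acotDiff_sq]
    field_simp
  rw [phaseIntegrand, exp_I_mul_eq_of_sq_eq_one hσ, e2, e1, e3]
  have hx := one_add_sq_ne_zero x
  have hxy : (1 + ((x : ℂ) + y) ^ 2) ≠ 0 := by exact_mod_cast one_add_sq_ne_zero (x + y)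
  generalize Real.sin (acotDiff x y / 2) = S at *
  generalize Real.cos (acotDiff x y / 2) = C at *
  have hc' : (C : ℂ) ≠ 0 := by exact_mod_cast hc
  have hs' : (S : ℂ) ≠ 0 := by exact_mod_cast hs
  push_cast
  field_simp
  ring

/-- Each logarithm diverges, but `tan (δ/2) / y` tends to the same nonzero slope from both sides, so
the `log |y|` parts cancel. -/
theorem tendsto_log_tan_half_acotDiff_sub (x : ℝ) :
    Tendsto (fun ε => Real.log (Real.tan (acotDiff x (-ε) / 2)) -
      Real.log (Real.tan (acotDiff x ε / 2))) (𝓝[>] 0) (𝓝 0) := by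
  set g : ℝ → ℝ := fun y => Real.tan (acotDiff x y / 2) with hg
  have hd := hasDerivAt_tan_half_acotDiff x 0
  have hg0 : g 0 = 0 := by simp [hg, acotDiff_zero]
  set d : ℝ := -(1 / (1 + (x + 0) ^ 2)) / (2 * Real.cos (acotDiff x 0 / 2) ^ 2) with hdd
  have hdne : d ≠ 0 := by
    have := cos_half_acotDiff_pos x 0
    have h : 0 < (1 / (1 + (x + 0) ^ 2)) / (2 * Real.cos (acotDiff x 0 / 2) ^ 2) := by positivity
    rw [hdd, neg_div]
    linarith
  have h1 : Tendsto (fun ε => ε⁻¹ * g ε) (𝓝[>] 0) (𝓝 d) := by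
    have h0 : Real.tan (acotDiff x 0 / 2) = 0 := hg0
    simpa only [zero_add, h0, sub_zero, smul_eq_mul] using hd.tendsto_slope_zero_right
  have hneg : Tendsto (fun ε : ℝ => -ε) (𝓝[>] 0) (𝓝[<] 0) := by
    have := tendsto_neg_nhdsGT (a := (0 : ℝ))
    rwa [neg_zero] at this
  have h2 : Tendsto (fun ε => (-ε)⁻¹ * g (-ε)) (𝓝[>] 0) (𝓝 d) := by
    have := hd.tendsto_slope_zero_left.comp hneg
    refine this.congr fun ε => ?_
    have h0 : Real.tan (acotDiff x 0 / 2) = 0 := hg0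
    simp only [Function.comp_apply, zero_add, h0, sub_zero, smul_eq_mul]
    rfl
  have h3 := (h2.log hdne).sub (h1.log hdne)
  rw [sub_self] at h3
  refine h3.congr' ?_
  filter_upwards [self_mem_nhdsWithin] with ε hε
  have hε : 0 < ε := hε
  rw [Real.log_mul (inv_ne_zero (neg_ne_zero.2 hε.ne'))
      (tan_half_acotDiff_ne_zero x (neg_ne_zero.2 hε.ne')),
    Real.log_mul (inv_ne_zero hε.ne') (tan_half_acotDiff_ne_zero x hε.ne'), inv_neg,
    Real.log_neg_eq_log]
  ring

theorem hasPV_phaseIntegrand_base {k : ℤ} (hk : k = 1 ∨ k = -1) (x : ℝ) :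
    HasPV (phaseIntegrand k x) (2 * Real.sin (acot x) -
      2 * Complex.I * k * Real.sin (acot x) ^ 2 * Real.log (Real.cot (acot x / 2))) := by
  have hσ : (k : ℂ) = 1 ∨ (k : ℂ) = -1 := by
    rcases hk with rfl | rfl
    · left; simp
    · right; simp
  set s := acot x with hs
  have hs0 : 0 < s := acot_pos x
  have hsp : s < Real.pi := acot_lt_pi x
  have hc : 0 < Real.cos (s / 2) := Real.cos_pos_of_mem_Ioo ⟨by linarith, by linarith⟩
  have hsn : 0 < Real.sin (s / 2) := Real.sin_pos_of_pos_of_lt_pi (by linarith) (by linarith)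
  have hto : ∀ {l : Filter ℝ} {a : ℝ}, Tendsto (acotDiff x) l (𝓝 a) → Real.cos (a / 2) ≠ 0 →
      Real.tan (a / 2) ≠ 0 → Tendsto (basePrimitive k x) l
        (𝓝 (-(1 / (1 + (x : ℂ) ^ 2)) * ((Real.tan (a / 2) : ℂ) -
          Complex.I * k * (Real.log (Real.tan (a / 2)) : ℂ)))) := by
    intro l a ha hca hta
    have ht := (Real.continuousAt_tan.2 hca).tendsto.comp (ha.div_const 2)
    have hl := ht.log hta
    exact (((Complex.continuous_ofReal.tendsto _).comp ht).sub
      (((Complex.continuous_ofReal.tendsto _).comp hl).const_mul _)).const_mul _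
  -- At `-∞` and `+∞` the half angle tends to `(π - s)/2` and `-s/2`; the tangents there are `cot
  -- (s/2)` and `-tan (s/2)`, so the two logarithms are opposite and their difference doubles.
  have ebot : Real.tan ((Real.pi - s) / 2) = Real.cos (s / 2) / Real.sin (s / 2) := by
    rw [sub_div, Real.tan_pi_div_two_sub, Real.tan_eq_sin_div_cos, inv_div]
  have etop : Real.tan (-s / 2) = -(Real.sin (s / 2) / Real.cos (s / 2)) := by
    rw [neg_div, Real.tan_neg, Real.tan_eq_sin_div_cos]
  have hbot := hto (tendsto_acotDiff_atBot x)
    (by rw [sub_div, Real.cos_pi_div_two_sub]; exact hsn.ne') (by rw [ebot]; positivity)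
  have htop := hto (tendsto_acotDiff_atTop x)
    (by rw [neg_div, Real.cos_neg]; exact hc.ne') (by rw [etop, neg_ne_zero]; positivity)
  have hzero : Tendsto (fun ε => basePrimitive k x (-ε) - basePrimitive k x ε) (𝓝[>] 0) (𝓝 0) := by
    have hcont : ContinuousAt (fun y => Real.tan (acotDiff x y / 2)) 0 :=
      (hasDerivAt_tan_half_acotDiff x 0).continuousAt
    have hneg : Tendsto (fun ε : ℝ => -ε) (𝓝[>] 0) (𝓝 0) := by
      have := (continuous_neg (G := ℝ)).tendsto 0
      rw [neg_zero] at this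
      exact this.mono_left nhdsWithin_le_nhds
    have h1 := (hcont.tendsto.comp hneg).sub (hcont.tendsto.mono_left (nhdsWithin_le_nhds (s := Set.Ioi 0)))
    have h2 := tendsto_log_tan_half_acotDiff_sub x
    have h3 := (((Complex.continuous_ofReal.tendsto _).comp h1).sub
      (((Complex.continuous_ofReal.tendsto _).comp h2).const_mul (Complex.I * k))).const_mul
        (-(1 / (1 + (x : ℂ) ^ 2)))
    simp only [sub_self, Complex.ofReal_zero, mul_zero] at h3
    refine h3.congr fun ε => ?_
    simp only [Function.comp_apply, basePrimitive]
    push_cast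
    ring
  refine (HasPV.of_hasDerivAt (fun ε hε => integrableOn_phaseIntegrand k x hε)
    (fun y hy => hasDerivAt_basePrimitive hσ x hy) hbot htop hzero).congr (fun _ _ => rfl) ?_
  have e1 : (1 / (1 + (x : ℂ) ^ 2)) = (Real.sin s : ℂ) ^ 2 := by
    rw [hs, ← Complex.ofReal_pow (Real.sin (acot x)), sin_acot_sq]; push_cast; rfl
  have e2 : Real.sin s = 2 * Real.sin (s / 2) * Real.cos (s / 2) := by
    rw [← Real.sin_two_mul]; ring_nf
  have e3 : Real.log (Real.sin (s / 2) / Real.cos (s / 2)) =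
      - Real.log (Real.cos (s / 2) / Real.sin (s / 2)) := by
    rw [← Real.log_inv, inv_div]
  rw [e1, ebot, etop, Real.log_neg_eq_log, e3, Real.cot_eq_cos_div_sin]
  generalize Real.log (Real.cos (s / 2) / Real.sin (s / 2)) = l
  have hp : Real.sin (s / 2) ^ 2 + Real.cos (s / 2) ^ 2 = 1 := Real.sin_sq_add_cos_sq _
  have hp' : (Real.sin (s / 2) : ℂ) ^ 2 + (Real.cos (s / 2) : ℂ) ^ 2 = 1 := by exact_mod_cast hp
  rw [e2]
  have hc' : (Real.cos (s / 2) : ℂ) ≠ 0 := by exact_mod_cast hc.ne'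
  have hsn' : (Real.sin (s / 2) : ℂ) ≠ 0 := by exact_mod_cast hsn.ne'
  push_cast [-Complex.ofReal_sin, -Complex.ofReal_cos]
  generalize (Real.sin (s / 2) : ℂ) = S at *
  generalize (Real.cos (s / 2) : ℂ) = C at *
  field_simp
  linear_combination 4 * S * C * hp'

/-! ### The recurrence in the frequency -/

/-- The antiderivative is `(i/k) e^{ikδ}`. For odd `k`, `e^{ikπ} = -1`, so the contributions of the
two ends add up instead of cancelling. -/
theorem hasPV_exp_div (k : ℤ) (hk : Odd k) (x : ℝ) :
    HasPV (fun y => Complex.exp (Complex.I * k * acotDiff x y) / (1 + ((x : ℂ) + y) ^ 2))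
      (2 * Complex.I / k * Complex.exp (-(Complex.I * k * acot x))) := by
  have hk0 : (k : ℂ) ≠ 0 := by
    rintro h
    have : k = 0 := by exact_mod_cast h
    subst this
    simp at hk
  have hcont : Continuous fun y : ℝ => Complex.exp (Complex.I * k * acotDiff x y) := by
    have := continuous_acotDiff x
    fun_prop
  have hxy : ∀ y : ℝ, (1 + ((x : ℂ) + y) ^ 2) ≠ 0 := fun y => by
    exact_mod_cast one_add_sq_ne_zero (x + y)
  have hint : Integrable
      fun y : ℝ => Complex.exp (Complex.I * k * acotDiff x y) / (1 + ((x : ℂ) + y) ^ 2) := by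
    have h1 : Integrable fun y : ℝ => (1 + (x + y) ^ 2)⁻¹ := integrable_inv_one_add_sq.comp_add_left x
    refine Integrable.mono' h1 ?_ (ae_of_all _ fun y => ?_)
    · exact (hcont.div (by fun_prop) hxy).aestronglyMeasurable
    · rw [norm_div, norm_exp_I_mul_int_mul, one_div,
        show (1 + ((x : ℂ) + y) ^ 2) = ((1 + (x + y) ^ 2 : ℝ) : ℂ) by push_cast; rfl,
        Complex.norm_real, Real.norm_of_nonneg (by positivity)]
  set F : ℝ → ℂ := fun y => Complex.I / k * Complex.exp (Complex.I * k * acotDiff x y) with hF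
  have hto : ∀ {l : Filter ℝ} {a : ℝ}, Tendsto (acotDiff x) l (𝓝 a) →
      Tendsto F l (𝓝 (Complex.I / k * Complex.exp (Complex.I * k * a))) := by
    intro l a ha
    have hc : Continuous fun t : ℝ => Complex.I / k * Complex.exp (Complex.I * k * t) := by fun_prop
    exact (hc.tendsto a).comp ha
  have hzero : Tendsto (fun ε => F (-ε) - F ε) (𝓝[>] 0) (𝓝 0) := by
    have hFc : Continuous F := continuous_const.mul hcont
    have : Continuous fun ε => F (-ε) - F ε := (hFc.comp continuous_neg).sub hFc
    have := this.tendsto 0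
    simp only [neg_zero, sub_self] at this
    exact this.mono_left nhdsWithin_le_nhds
  refine (HasPV.of_hasDerivAt (fun ε _ => hint.integrableOn) (fun y _ => ?_)
    (hto (tendsto_acotDiff_atBot x)) (hto (tendsto_acotDiff_atTop x)) hzero).congr
    (fun _ _ => rfl) ?_
  · have h := (((hasDerivAt_acotDiff x y).ofReal_comp.const_mul (Complex.I * k)).cexp).const_mul
      (Complex.I / k)
    refine h.congr_deriv ?_
    have := hxy y
    push_cast
    field_simp
    linear_combination -Complex.I_sq
  · have hpi : Complex.exp (Complex.I * k * Real.pi) = -1 := by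
      obtain ⟨m, rfl⟩ := hk
      rw [show Complex.I * ((2 * m + 1 : ℤ) : ℂ) * Real.pi =
        m * (2 * Real.pi * Complex.I) + Real.pi * Complex.I by push_cast; ring,
        Complex.exp_add, Complex.exp_int_mul_two_pi_mul_I, Complex.exp_pi_mul_I, one_mul]
    have : Complex.exp (Complex.I * k * ((Real.pi - acot x : ℝ) : ℂ)) =
        - Complex.exp (-(Complex.I * k * acot x)) := by
      rw [show Complex.I * k * ((Real.pi - acot x : ℝ) : ℂ) =
        Complex.I * k * Real.pi + -(Complex.I * k * acot x) by push_cast; ring,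
        Complex.exp_add, hpi]
      ring
    rw [this]
    push_cast
    rw [mul_neg]
    ring

/-- The numerators combine to `e^{ikδ} (2 - 2 cos 2δ) = 4 e^{ikδ} sin² δ`, and `sin² δ` cancels the
`y²` below. -/
theorem phaseIntegrand_second_difference (k : ℂ) (x : ℝ) {y : ℝ} (hy : y ≠ 0) :
    phaseIntegrand (k + 2) x y - 2 * phaseIntegrand k x y + phaseIntegrand (k - 2) x y =
      4 * Real.sin (acot x) ^ 2 *
        (Complex.exp (Complex.I * k * acotDiff x y) / (1 + ((x : ℂ) + y) ^ 2)) := by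
  have hxy : (1 + ((x : ℂ) + y) ^ 2) ≠ 0 := by exact_mod_cast one_add_sq_ne_zero (x + y)
  have hx := one_add_sq_ne_zero x
  have hy' : (y : ℂ) ≠ 0 := by exact_mod_cast hy
  have e1 : (Real.sin (acot x) : ℂ) ^ 2 = 1 / (1 + (x : ℂ) ^ 2) := by
    rw [← Complex.ofReal_pow, sin_acot_sq]; push_cast; rfl
  have e2 : Complex.sin (acotDiff x y) ^ 2 = (y : ℂ) ^ 2 / ((1 + (x : ℂ) ^ 2) *
      (1 + ((x : ℂ) + y) ^ 2)) := by
    have := sin_acotDiff_sq x y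
    exact_mod_cast congrArg (fun r : ℝ => (r : ℂ)) this
  have e3 : Complex.exp (Complex.I * 2 * acotDiff x y) + Complex.exp (-(Complex.I * 2 * acotDiff x y))
      = 2 - 4 * Complex.sin (acotDiff x y) ^ 2 := by
    have := Complex.two_cos (2 * (acotDiff x y : ℂ))
    rw [Complex.cos_two_mul, Complex.cos_sq'] at this
    rw [show Complex.I * 2 * acotDiff x y = 2 * (acotDiff x y : ℂ) * Complex.I by ring, ← neg_mul,
      ← this]
    ring
  have e4 : Complex.exp (Complex.I * (k + 2) * acotDiff x y) =
      Complex.exp (Complex.I * k * acotDiff x y) * Complex.exp (Complex.I * 2 * acotDiff x y) := by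
    rw [← Complex.exp_add]; ring_nf
  have e5 : Complex.exp (Complex.I * (k - 2) * acotDiff x y) =
      Complex.exp (Complex.I * k * acotDiff x y) *
        Complex.exp (-(Complex.I * 2 * acotDiff x y)) := by
    rw [← Complex.exp_add]; ring_nf
  rw [e2] at e3
  simp only [phaseIntegrand, e4, e5, e1]
  generalize Complex.exp (Complex.I * k * acotDiff x y) = E at *
  generalize Complex.exp (Complex.I * 2 * acotDiff x y) = P at *
  generalize Complex.exp (-(Complex.I * 2 * acotDiff x y)) = Q at *
  rw [show (1 - E * P) / ((y ^ 2 : ℝ) : ℂ) - 2 * ((1 - E) / ((y ^ 2 : ℝ) : ℂ)) +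
    (1 - E * Q) / ((y ^ 2 : ℝ) : ℂ) = E * (2 - (P + Q)) / ((y ^ 2 : ℝ) : ℂ) by ring, e3]
  push_cast
  field_simp
  ring

theorem hasPV_phaseIntegrand_of_recurrence {W : ℤ → ℂ} (x : ℝ)
    (h1 : W 1 = 2 * Real.sin (acot x) -
      2 * Complex.I * Real.sin (acot x) ^ 2 * Real.log (Real.cot (acot x / 2)))
    (hm1 : W (-1) = 2 * Real.sin (acot x) +
      2 * Complex.I * Real.sin (acot x) ^ 2 * Real.log (Real.cot (acot x / 2)))
    (hW : ∀ k : ℤ, Odd k → W (k + 2) - 2 * W k + W (k - 2) =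
      4 * Real.sin (acot x) ^ 2 * (2 * Complex.I / k * Complex.exp (-(Complex.I * k * acot x))))
    {k : ℤ} (hk : Odd k) : HasPV (phaseIntegrand k x) (W k) := by
  -- The recurrence has order two, so the induction carries a pair of neighbouring odd frequencies,
  -- starting from `(-1, 1)` and going both ways.
  have key : ∀ m : ℤ, HasPV (phaseIntegrand (2 * m - 1 : ℤ) x) (W (2 * m - 1)) ∧
      HasPV (phaseIntegrand (2 * m + 1 : ℤ) x) (W (2 * m + 1)) := by
    intro m
    induction m using Int.induction_on with
    | zero =>
      constructor
      · refine (hasPV_phaseIntegrand_base (Or.inr rfl) x).congr (fun y _ => rfl) ?_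
        rw [show (2 * 0 - 1 : ℤ) = -1 by rfl, hm1]
        push_cast; ring
      · refine (hasPV_phaseIntegrand_base (Or.inl rfl) x).congr (fun y _ => rfl) ?_
        rw [show (2 * 0 + 1 : ℤ) = 1 by rfl, h1]
        push_cast; ring
    | succ m ih =>
      have ho : Odd (2 * (m : ℤ) + 1) := ⟨m, rfl⟩
      rw [show (2 * ((m : ℤ) + 1) - 1) = 2 * m + 1 by ring,
        show (2 * ((m : ℤ) + 1) + 1) = 2 * m + 1 + 2 by ring]
      refine ⟨ih.2, ?_⟩
      have h := (((hasPV_exp_div _ ho x).const_mul (4 * (Real.sin (acot x) : ℂ) ^ 2)).add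
        (ih.2.const_mul 2)).add (ih.1.const_mul (-1))
      refine h.congr (fun y hy => ?_) ?_
      · rw [← phaseIntegrand_second_difference _ x hy]
        push_cast
        rw [show (2 * (m : ℂ) + 1 - 2) = 2 * m - 1 by ring]
        ring
      · rw [← hW _ ho, show (2 * (m : ℤ) + 1 - 2) = 2 * m - 1 by ring]
        ring
    | pred m ih =>
      have ho : Odd (2 * (-m : ℤ) - 1) := ⟨-m - 1, by ring⟩
      rw [show (2 * (-(m : ℤ) - 1) - 1) = 2 * (-m) - 1 - 2 by ring,
        show (2 * (-(m : ℤ) - 1) + 1) = 2 * (-m) - 1 by ring]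
      refine ⟨?_, ih.1⟩
      have h := (((hasPV_exp_div _ ho x).const_mul (4 * (Real.sin (acot x) : ℂ) ^ 2)).add
        (ih.1.const_mul 2)).add (ih.2.const_mul (-1))
      refine h.congr (fun y hy => ?_) ?_
      · rw [← phaseIntegrand_second_difference _ x hy]
        push_cast
        rw [show (2 * (-m : ℂ) - 1 + 2) = 2 * (-m) + 1 by ring]
        ring
      · rw [← hW _ ho, show (2 * (-m : ℤ) - 1 + 2) = 2 * (-m) + 1 by ring]
        ring
  obtain ⟨m, rfl⟩ := hk
  exact (key m).2

/-! ### Sums over odd integers -/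

theorem Odd.cast_ne_zero {j : ℤ} (hj : Odd j) : (j : ℂ) ≠ 0 := by
  intro h
  have : j = 0 := by exact_mod_cast h
  subst this
  simp at hj

theorem Odd.cast_add_two_ne_zero {j : ℤ} (hj : Odd j) : (j : ℂ) + 2 ≠ 0 := by
  have := Odd.cast_ne_zero (hj.add_even even_two)
  exact_mod_cast this

theorem Odd.cast_sub_two_ne_zero {j : ℤ} (hj : Odd j) : (j : ℂ) - 2 ≠ 0 := by
  have := Odd.cast_ne_zero (hj.sub_even even_two)
  exact_mod_cast this

/-- The summand `e ^ (i j s) / ((j - 2) j (j + 2))`. -/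
noncomputable def oddTerm (s : ℝ) (j : ℤ) : ℂ :=
  Complex.exp (Complex.I * j * s) / (((j : ℂ) - 2) * j * (j + 2))

/-- The sum of `oddTerm s j` over `j = -k, -k + 2, -k + 4, …`. -/
noncomputable def oddSum (s : ℝ) (k : ℤ) : ℂ := ∑' n : ℕ, oddTerm s (2 * n - k)

theorem norm_oddTerm_le (s : ℝ) (n : ℕ) : ‖oddTerm s (2 * n + 1)‖ ≤ 1 / ((n : ℝ) + 1) ^ 2 := by
  rw [oddTerm, norm_div, norm_exp_I_mul_int_mul]
  have hn : (0 : ℝ) ≤ n := n.cast_nonneg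
  have e : (((2 * n + 1 : ℤ) : ℂ) - 2) * (2 * n + 1 : ℤ) * ((2 * n + 1 : ℤ) + 2) =
      (((2 * n - 1 : ℤ) : ℝ) * (2 * n + 1) * (2 * n + 3) : ℝ) := by push_cast; ring
  rw [e, Complex.norm_real, norm_mul, norm_mul, Real.norm_of_nonneg (by positivity : (0 : ℝ) ≤ 2 * n + 1),
    Real.norm_of_nonneg (by positivity : (0 : ℝ) ≤ 2 * n + 3), Real.norm_eq_abs]
  -- The factor `2n - 1` is `-1` at `n = 0`; bounding its absolute value below by 1 is enough, as
  -- the other two factors already give quadratic decay.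
  have h1 : (1 : ℝ) ≤ |((2 * n - 1 : ℤ) : ℝ)| := by
    have : (1 : ℤ) ≤ |(2 * n - 1 : ℤ)| := Int.one_le_abs (by omega)
    exact_mod_cast this
  have h2 : ((n : ℝ) + 1) ^ 2 ≤ 1 * (2 * n + 1) * (2 * n + 3) := by nlinarith
  gcongr
  exact h2.trans (by gcongr)

theorem summable_one_div_nat_succ_sq : Summable fun n : ℕ => 1 / ((n : ℝ) + 1) ^ 2 := by
  have := (summable_nat_add_iff 1).2 (Real.summable_one_div_nat_pow.2 one_lt_two)
  exact_mod_cast this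

/-- Replacing `k` by `k + 2` only puts one more term in front of the series. -/
theorem summable_oddTerm_iff (s : ℝ) (k : ℤ) :
    (Summable fun n : ℕ => oddTerm s (2 * n - (k + 2))) ↔
      Summable fun n : ℕ => oddTerm s (2 * n - k) := by
  rw [← summable_nat_add_iff 1]
  refine summable_congr fun n => ?_
  congr 1
  push_cast
  ring

theorem summable_oddTerm (s : ℝ) {k : ℤ} (hk : Odd k) :
    Summable fun n : ℕ => oddTerm s (2 * n - k) := by
  obtain ⟨m, rfl⟩ := hk
  have h0 : Summable fun n : ℕ => oddTerm s (2 * n - (-1)) :=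
    Summable.of_norm_bounded summable_one_div_nat_succ_sq fun n => by
      rw [sub_neg_eq_add]; exact norm_oddTerm_le s n
  induction m using Int.induction_on with
  | zero =>
    rw [show (2 * 0 + 1 : ℤ) = -1 + 2 by norm_num]
    exact (summable_oddTerm_iff s (-1)).2 h0
  | succ m ih =>
    rw [show (2 * ((m : ℤ) + 1) + 1) = 2 * m + 1 + 2 by ring]
    exact (summable_oddTerm_iff s _).2 ih
  | pred m ih =>
    rw [show (2 * (-(m : ℤ)) + 1) = 2 * (-m - 1) + 1 + 2 by ring] at ih
    exact (summable_oddTerm_iff s _).1 ih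

theorem oddSum_add_two (s : ℝ) {k : ℤ} (hk : Odd k) :
    oddSum s (k + 2) = oddTerm s (-(k + 2)) + oddSum s k := by
  rw [oddSum, ((summable_oddTerm_iff s k).2 (summable_oddTerm s hk)).tsum_eq_zero_add, oddSum]
  congr 1
  · congr 1; push_cast; ring
  · refine tsum_congr fun n => ?_
    congr 1
    push_cast
    ring

theorem oddSum_of_pos (s : ℝ) (m : ℕ) :
    oddSum s (2 * m + 1) = oddSum s (-1) + ∑ n ∈ Finset.range (m + 1), oddTerm s (-(2 * n + 1)) := by
  induction m with
  | zero =>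
    have := oddSum_add_two s (k := -1) (by decide)
    rw [show (-1 + 2 : ℤ) = 2 * (0 : ℕ) + 1 by norm_num] at this
    rw [this]
    simp [add_comm]
  | succ m ih =>
    rw [show (2 * ((m + 1 : ℕ) : ℤ) + 1) = 2 * m + 1 + 2 by push_cast; ring,
      oddSum_add_two s ⟨(m : ℤ), rfl⟩, ih, Finset.sum_range_succ _ (m + 1)]
    push_cast
    ring_nf

theorem oddSum_of_neg (s : ℝ) (m : ℕ) :
    oddSum s (-(2 * m + 1)) = oddSum s (-1) - ∑ n ∈ Finset.range m, oddTerm s (2 * n + 1) := by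
  induction m with
  | zero => simp
  | succ m ih =>
    have h := oddSum_add_two s (k := -(2 * m + 1) - 2) ⟨-(m : ℤ) - 2, by ring⟩
    rw [sub_add_cancel, ih, neg_neg] at h
    rw [show -(2 * ((m + 1 : ℕ) : ℤ) + 1) = -(2 * m + 1) - 2 by push_cast; ring,
      Finset.sum_range_succ]
    linear_combination -h

/-! ### Closed form of the half-line sum -/

theorem hasSum_of_eq {f g : ℕ → ℂ} {a b : ℂ} (h : HasSum f a) (hfg : ∀ n, g n = f n)
    (hab : b = a) : HasSum g b := by
  rw [hab, funext hfg]
  exact h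

/-- The artanh series, read off from the arctangent series at `-iz`. -/
theorem hasSum_odd_pow_div {z : ℂ} (hz : ‖z‖ < 1) :
    HasSum (fun n : ℕ => z ^ (2 * n + 1) / ((2 * n + 1 : ℕ) : ℂ))
      (Complex.log ((1 + z) / (1 - z)) / 2) := by
  have h := (Complex.hasSum_arctan (z := -Complex.I * z) (by simpa using hz)).mul_left Complex.I
  have e1 : -Complex.I * z * Complex.I = z := by linear_combination -z * Complex.I_sq
  rw [Complex.arctan, e1] at h
  refine hasSum_of_eq h (fun n => ?_) ?_
  · have : (-Complex.I) ^ (2 * n + 1) = (-1) ^ n * (-Complex.I) := by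
      rw [pow_succ, pow_mul, neg_sq, Complex.I_sq]
    rw [mul_pow, this]
    have h1 : ((-1 : ℂ) ^ n) * (-1) ^ n = 1 := by rw [← mul_pow]; simp
    linear_combination (z ^ (2 * n + 1) / ((2 * n + 1 : ℕ) : ℂ)) *
      (-h1 + (-1 : ℂ) ^ n * (-1) ^ n * Complex.I_sq)
  · linear_combination (Complex.log ((1 + z) / (1 - z)) / 2) * Complex.I_sq

/-- Partial fractions: `8 / ((j-2) j (j+2)) = 1/(j-2) - 2/j + 1/(j+2)`, each piece being an index
shift of the artanh series. The factor `z²` keeps the statement free of division by `z`. -/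
theorem hasSum_odd_pow_div_cubic {z : ℂ} (hz : ‖z‖ < 1) :
    HasSum (fun n : ℕ => 8 * z ^ 2 * (z ^ (2 * n + 1) /
        (((2 * n + 1 : ℂ) - 2) * (2 * n + 1) * (2 * n + 1 + 2))))
      ((z ^ 2 - 1) ^ 2 * (Complex.log ((1 + z) / (1 - z)) / 2) - z * (z ^ 2 + 1)) := by
  have hA := hasSum_odd_pow_div hz
  set A := Complex.log ((1 + z) / (1 - z)) / 2
  have h1 : HasSum (fun n : ℕ => z ^ (2 * n + 1) / ((2 * n + 1 : ℂ) - 2)) (z ^ 2 * A - z) := by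
    refine (hasSum_nat_add_iff' 1).1 (hasSum_of_eq (hA.mul_left (z ^ 2)) (fun n => ?_) ?_)
    · push_cast
      rw [show (2 * ((n : ℂ) + 1) + 1 - 2) = 2 * n + 1 by ring]
      ring
    · norm_num
      ring
  have h2 : HasSum (fun n : ℕ => z ^ 2 * (z ^ (2 * n + 1) / ((2 * n + 1 : ℂ) + 2))) (A - z) := by
    have := (hasSum_nat_add_iff' 1).2 hA
    refine hasSum_of_eq this (fun n => ?_) ?_
    · push_cast
      rw [show (2 * ((n : ℂ) + 1) + 1) = 2 * n + 1 + 2 by ring]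
      ring
    · norm_num
  refine hasSum_of_eq (((h1.mul_left (z ^ 2)).sub (hA.mul_left (2 * z ^ 2))).add h2)
    (fun n => ?_) (by ring)
  have ho : Odd (2 * (n : ℤ) + 1) := ⟨n, rfl⟩
  have a1 := Odd.cast_ne_zero ho
  have a2 := Odd.cast_add_two_ne_zero ho
  have a3 := Odd.cast_sub_two_ne_zero ho
  push_cast at a1 a2 a3 ⊢
  field_simp
  ring

theorem exp_I_mul_eq_half_sq (s : ℝ) : Complex.exp (Complex.I * s) =
    ((Real.cos (s / 2) : ℂ) + Complex.I * Real.sin (s / 2)) ^ 2 := by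
  rw [show Complex.I * (s : ℂ) = ((2 : ℕ) : ℂ) * (((s / 2 : ℝ) : ℂ) * Complex.I) by push_cast; ring,
    Complex.exp_nat_mul, Complex.exp_mul_I]
  push_cast
  ring

/-- For `s` in `(0, π)` this is a positive multiple of `i`, hence off the branch cut, and its
logarithm has imaginary part exactly `π/2`. -/
theorem one_add_exp_div_one_sub_exp {s : ℝ} (hs : s ∈ Set.Ioo 0 Real.pi) :
    (1 + Complex.exp (Complex.I * s)) / (1 - Complex.exp (Complex.I * s)) =
      (Real.cot (s / 2) : ℂ) * Complex.I := by
  have hsn : 0 < Real.sin (s / 2) :=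
    Real.sin_pos_of_pos_of_lt_pi (by linarith [hs.1]) (by linarith [hs.1, hs.2])
  have hp : Real.sin (s / 2) ^ 2 + Real.cos (s / 2) ^ 2 = 1 := Real.sin_sq_add_cos_sq _
  have hp' : (Real.sin (s / 2) : ℂ) ^ 2 + (Real.cos (s / 2) : ℂ) ^ 2 = 1 := by exact_mod_cast hp
  have hsn' : (Real.sin (s / 2) : ℂ) ≠ 0 := by exact_mod_cast hsn.ne'
  have hne : (Real.cos (s / 2) : ℂ) + Complex.I * Real.sin (s / 2) ≠ 0 := by
    intro h
    have := exp_I_mul_eq_half_sq s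
    rw [h] at this
    exact Complex.exp_ne_zero _ (by rw [this]; ring)
  rw [exp_I_mul_eq_half_sq, Real.cot_eq_cos_div_sin, Complex.ofReal_div]
  generalize (Real.sin (s / 2) : ℂ) = S at *
  generalize (Real.cos (s / 2) : ℂ) = C at *
  have e1 : 1 - (C + Complex.I * S) ^ 2 = -2 * Complex.I * S * (C + Complex.I * S) := by
    linear_combination -hp' + S ^ 2 * Complex.I_sq
  have e2 : 1 + (C + Complex.I * S) ^ 2 = 2 * C * (C + Complex.I * S) := by
    linear_combination -hp' + S ^ 2 * Complex.I_sq
  rw [e1, e2]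
  have hI := Complex.I_ne_zero
  field_simp
  linear_combination -C * Complex.I_sq

/-- The closed form for `‖z‖ < 1` is carried to `w = e^{is}` by letting `z = r w`, `r → 1⁻`; the
series converges by domination with `8 / (n + 1)²`. -/
theorem oddSum_neg_one {s : ℝ} (hs : s ∈ Set.Ioo 0 Real.pi) :
    oddSum s (-1) = -(1 / 4) * ((Real.cos s : ℂ) + Real.sin s ^ 2 *
      ((Real.log (Real.cot (s / 2)) : ℂ) + Complex.I * Real.pi / 2)) := by
  set w := Complex.exp (Complex.I * s) with hw
  have hnorm : ‖w‖ = 1 := by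
    rw [hw, mul_comm, Complex.norm_exp_ofReal_mul_I]
  have hcot : 0 < Real.cot (s / 2) := by
    rw [Real.cot_eq_cos_div_sin]
    exact div_pos (Real.cos_pos_of_mem_Ioo ⟨by linarith [hs.1, Real.pi_pos], by linarith [hs.2]⟩)
      (Real.sin_pos_of_pos_of_lt_pi (by linarith [hs.1]) (by linarith [hs.1, hs.2]))
  have hratio := one_add_exp_div_one_sub_exp hs
  rw [← hw] at hratio
  have hlog : Complex.log ((1 + w) / (1 - w)) =
      (Real.log (Real.cot (s / 2)) : ℂ) + Complex.I * Real.pi / 2 := by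
    rw [hratio, Complex.log_ofReal_mul hcot Complex.I_ne_zero, Complex.log_I]
    ring
  have hslit : (1 + w) / (1 - w) ∈ Complex.slitPlane := by
    rw [hratio, Complex.mem_slitPlane_iff]
    right
    rw [Complex.im_ofReal_mul, Complex.I_im, mul_one]
    exact hcot.ne'
  have hw1 : 1 - w ≠ 0 := by
    intro h
    rw [h, div_zero] at hslit
    simp [Complex.mem_slitPlane_iff] at hslit
  set f : ℝ → ℕ → ℂ := fun r n => 8 * ((r : ℂ) * w) ^ 2 * (((r : ℂ) * w) ^ (2 * n + 1) /
        (((2 * n + 1 : ℂ) - 2) * (2 * n + 1) * (2 * n + 1 + 2))) with hf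
  have hterm : ∀ n : ℕ, w ^ (2 * n + 1) / (((2 * n + 1 : ℂ) - 2) * (2 * n + 1) * (2 * n + 1 + 2)) =
      oddTerm s (2 * n - (-1)) := by
    intro n
    rw [oddTerm, hw, ← Complex.exp_nat_mul]
    push_cast
    ring_nf
  have hleft : Tendsto (fun r : ℝ => ∑' n, f r n) (𝓝[<] 1) (𝓝 (∑' n, f 1 n)) := by
    refine tendsto_tsum_of_dominated_convergence
      (summable_one_div_nat_succ_sq.mul_left 8) (fun n => ?_) ?_
    · have : Continuous fun r => f r n := by
        simp only [hf]
        fun_prop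
      exact (this.tendsto 1).mono_left nhdsWithin_le_nhds
    · filter_upwards [Ioo_mem_nhdsLT (zero_lt_one' ℝ)] with r hr n
      have hr1 : ‖(r : ℂ)‖ ≤ 1 := by
        rw [Complex.norm_real, Real.norm_of_nonneg hr.1.le]; exact hr.2.le
      have e : f r n = (r : ℂ) ^ (2 * n + 3) * w ^ 2 * (8 * oddTerm s (2 * n + 1)) := by
        rw [← sub_neg_eq_add (2 * (n : ℤ)) 1, ← hterm]
        simp only [hf]
        ring
      rw [e, norm_mul, norm_mul, norm_pow, norm_pow, hnorm, norm_mul]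
      have h8 : ‖(8 : ℂ)‖ = 8 := by norm_num
      rw [h8, one_pow, mul_one]
      calc _ ≤ 1 * (8 * (1 / ((n : ℝ) + 1) ^ 2)) := by
            gcongr
            · exact pow_le_one₀ (norm_nonneg _) hr1
            · exact norm_oddTerm_le s n
        _ = _ := one_mul _
  have hright : Tendsto (fun r : ℝ => ((((r : ℂ) * w) ^ 2 - 1) ^ 2 *
      (Complex.log ((1 + (r : ℂ) * w) / (1 - (r : ℂ) * w)) / 2) -
        ((r : ℂ) * w) * (((r : ℂ) * w) ^ 2 + 1))) (𝓝[<] 1)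
      (𝓝 ((w ^ 2 - 1) ^ 2 * (Complex.log ((1 + w) / (1 - w)) / 2) - w * (w ^ 2 + 1))) := by
    have hz : Tendsto (fun r : ℝ => (r : ℂ) * w) (𝓝[<] 1) (𝓝 w) := by
      have : Continuous fun r : ℝ => (r : ℂ) * w := by fun_prop
      have := this.tendsto 1
      rw [Complex.ofReal_one, one_mul] at this
      exact this.mono_left nhdsWithin_le_nhds
    have hl := ((hz.const_add 1).div (hz.const_sub 1) hw1).clog hslit
    exact ((((hz.pow 2).sub_const 1).pow 2).mul (hl.div_const 2)).sub
      (hz.mul ((hz.pow 2).add_const 1))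
  have heq : ∑' n, f 1 n =
      (w ^ 2 - 1) ^ 2 * (Complex.log ((1 + w) / (1 - w)) / 2) - w * (w ^ 2 + 1) := by
    refine tendsto_nhds_unique hleft (hright.congr' ?_)
    filter_upwards [Ioo_mem_nhdsLT (zero_lt_one' ℝ)] with r hr
    refine (hasSum_odd_pow_div_cubic ?_).tsum_eq.symm
    rw [norm_mul, hnorm, mul_one, Complex.norm_real, Real.norm_of_nonneg hr.1.le]
    exact hr.2
  have h1 : ∑' n, f 1 n = 8 * w ^ 2 * oddSum s (-1) := by
    rw [oddSum, ← tsum_mul_left]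
    refine tsum_congr fun n => ?_
    rw [← hterm]
    simp only [hf, Complex.ofReal_one, one_mul]
  rw [h1, hlog] at heq
  have hwne : w ≠ 0 := Complex.exp_ne_zero _
  have e1 : w = (Real.cos s : ℂ) + Complex.I * Real.sin s := by
    rw [hw, mul_comm, Complex.exp_mul_I]; push_cast; ring
  have hp : (Real.sin s : ℂ) ^ 2 + (Real.cos s : ℂ) ^ 2 = 1 := by
    exact_mod_cast Real.sin_sq_add_cos_sq s
  -- Factoring `w` out of `w² ± 1` leaves a sine and a cosine, so the common factor `8 w²` can be
  -- cancelled.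
  have e2 : w ^ 2 - 1 = 2 * Complex.I * Real.sin s * w := by
    rw [e1]
    linear_combination hp - (Real.sin s : ℂ) ^ 2 * Complex.I_sq
  have e3 : w ^ 2 + 1 = 2 * Real.cos s * w := by
    rw [e1]
    linear_combination -hp + (Real.sin s : ℂ) ^ 2 * Complex.I_sq
  rw [e2, e3] at heq
  have h8 : (8 * w ^ 2) ≠ 0 := mul_ne_zero (by norm_num) (pow_ne_zero 2 hwne)
  refine mul_left_cancel₀ h8 (heq.trans ?_)
  linear_combination 2 * (Real.sin s : ℂ) ^ 2 * w ^ 2 *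
    ((Real.log (Real.cot (s / 2)) : ℂ) + Complex.I * Real.pi / 2) * Complex.I_sq

/-! ### The hypergeometric series -/

/-- Both sides are `(b)_{n+3}`. With `b = -k/2 - 1` the parameters differ by 3, so `(b)_n / (b+3)_n`
is a constant over a cubic in `n`, with factors `(j-2)/2`, `j/2`, `(j+2)/2` for `j = 2n - k`. -/
theorem ascPochhammer_eval_add_three (b : ℂ) (n : ℕ) :
    (ascPochhammer ℂ n).eval (b + 3) * (b * (b + 1) * (b + 2)) =
      (ascPochhammer ℂ n).eval b * ((b + n) * (b + n + 1) * (b + n + 2)) := by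
  induction n with
  | zero => simp
  | succ n ih =>
    rw [ascPochhammer_succ_eval, ascPochhammer_succ_eval]
    push_cast
    linear_combination (b + 3 + n) * ih

theorem hypTerm_eq {k : ℤ} (hk : Odd k) (s : ℝ) (n : ℕ) :
    hypTerm k (Complex.exp (2 * Complex.I * s)) n =
      k * (4 - (k : ℂ) ^ 2) * Complex.exp (Complex.I * k * s) * oddTerm s (2 * n - k) := by
  have hj : Odd (2 * (n : ℤ) - k) := Even.sub_odd ⟨n, by ring⟩ hk
  have a1 := Odd.cast_ne_zero hj
  have a2 := Odd.cast_add_two_ne_zero hj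
  have a3 := Odd.cast_sub_two_ne_zero hj
  have hp := ascPochhammer_eval_add_three (-(k : ℂ) / 2 - 1) n
  rw [show -(k : ℂ) / 2 - 1 + 3 = -(k : ℂ) / 2 + 2 by ring] at hp
  -- A zero would force `k = 2m + 4`, which is even.
  have hne : (ascPochhammer ℂ n).eval (-(k : ℂ) / 2 + 2) ≠ 0 := by
    intro h
    rw [ascPochhammer_eval_eq_zero_iff] at h
    obtain ⟨m, -, hm⟩ := h
    have h2 : (k : ℂ) = ((2 * m + 4 : ℤ) : ℂ) := by
      push_cast
      linear_combination (-2) * hm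
    have h3 : k = 2 * m + 4 := by exact_mod_cast h2
    rw [h3, ← Int.not_even_iff_odd] at hk
    exact hk ⟨m + 2, by ring⟩
  have hexp : Complex.exp (2 * Complex.I * s) ^ n = Complex.exp (Complex.I * k * s) *
      Complex.exp (Complex.I * (2 * n - k : ℤ) * s) := by
    rw [← Complex.exp_nat_mul, ← Complex.exp_add]
    push_cast
    ring_nf
  have hfac : (n.factorial : ℂ) ≠ 0 := by exact_mod_cast n.factorial_ne_zero
  have h1 : (ascPochhammer ℂ n).eval (1 : ℂ) = n.factorial := by
    rw [ascPochhammer_eval_one]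
  rw [hypTerm, ordinaryHypergeometricSeries_apply_eq, hexp, h1, oddTerm, smul_eq_mul]
  push_cast at a1 a2 a3 hp ⊢
  generalize (ascPochhammer ℂ n).eval (-(k : ℂ) / 2 + 2) = P at *
  generalize (ascPochhammer ℂ n).eval (-(k : ℂ) / 2 - 1) = Q at *
  field_simp
  linear_combination (-8) * hp

theorem summable_hypTerm {k : ℤ} (hk : Odd k) (s : ℝ) :
    Summable (hypTerm k (Complex.exp (2 * Complex.I * s))) :=
  ((summable_oddTerm s hk).mul_left _).congr fun n => (hypTerm_eq hk s n).symm

theorem ordinaryHypergeometric_eq_oddSum {k : ℤ} (hk : Odd k) (s : ℝ) :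
    ordinaryHypergeometric (1 : ℂ) (-(k : ℂ) / 2 - 1) (-(k : ℂ) / 2 + 2)
      (Complex.exp (2 * Complex.I * s)) =
      k * (4 - (k : ℂ) ^ 2) * Complex.exp (Complex.I * k * s) * oddSum s k := by
  rw [ordinaryHypergeometric, FormalMultilinearSeries.sum, oddSum, ← tsum_mul_left]
  exact tsum_congr fun n => hypTerm_eq hk s n

theorem oddTerm_neg (s : ℝ) (j : ℤ) : oddTerm s (-j) =
    -(Complex.exp (-(Complex.I * j * s)) / (((j : ℂ) - 2) * j * (j + 2))) := by
  have e : Complex.I * ((-j : ℤ) : ℂ) * s = -(Complex.I * j * s) := by push_cast; ring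
  rw [oddTerm, e, ← div_neg]
  push_cast
  ring_nf

/-! ### Series and closed form of the principal value -/

/-- The principal value of `phaseIntegrand k x` with `s = acot x`, in series form. -/
noncomputable def phaseValue (s : ℝ) (k : ℤ) : ℂ :=
  -(2 * Complex.I / (k + 2)) * Complex.exp (-(Complex.I * k * s)) -
    k * Real.pi * (Real.sin s : ℂ) ^ 2 + 8 * Complex.I * k * oddSum s k

/-- The term linear in `k` has no second difference, and in `k * oddSum s k` the infinite sums
cancel, leaving just the two boundary terms. -/
theorem phaseValue_recurrence (s : ℝ) {k : ℤ} (hk : Odd k) :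
    phaseValue s (k + 2) - 2 * phaseValue s k + phaseValue s (k - 2) =
      4 * (Real.sin s : ℂ) ^ 2 * (2 * Complex.I / k * Complex.exp (-(Complex.I * k * s))) := by
  have a0 := Odd.cast_ne_zero hk
  have a1 := Odd.cast_add_two_ne_zero hk
  have a2 := Odd.cast_sub_two_ne_zero hk
  have a3 : (k : ℂ) + 2 + 2 ≠ 0 := by
    have := Odd.cast_add_two_ne_zero (hk.add_even even_two)
    exact_mod_cast this
  have h1 := oddSum_add_two s hk
  have h2 := oddSum_add_two s (hk.sub_even even_two)
  rw [sub_add_cancel] at h2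
  have e1 : Complex.exp (-(Complex.I * ((k + 2 : ℤ) : ℂ) * s)) =
      Complex.exp (-(Complex.I * k * s)) * Complex.exp (-(2 * s) * Complex.I) := by
    rw [← Complex.exp_add]; push_cast; ring_nf
  have e2 : Complex.exp (-(Complex.I * ((k - 2 : ℤ) : ℂ) * s)) =
      Complex.exp (-(Complex.I * k * s)) * Complex.exp (2 * s * Complex.I) := by
    rw [← Complex.exp_add]; push_cast; ring_nf
  have e3 : Complex.exp (2 * s * Complex.I) + Complex.exp (-(2 * s) * Complex.I) =
      2 - 4 * (Real.sin s : ℂ) ^ 2 := by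
    rw [← Complex.two_cos, Complex.cos_two_mul, Complex.cos_sq']
    push_cast
    ring
  rw [oddTerm_neg, e1] at h1
  rw [oddTerm_neg] at h2
  rw [phaseValue, phaseValue, phaseValue, e1, e2, h1, h2]
  generalize Complex.exp (-(Complex.I * k * s)) = E at *
  generalize Complex.exp (2 * s * Complex.I) = p at *
  generalize Complex.exp (-(2 * s) * Complex.I) = q at *
  have e4 : p = 2 - 4 * (Real.sin s : ℂ) ^ 2 - q := by linear_combination e3
  rw [e4]
  push_cast
  rw [show (k : ℂ) - 2 + 2 = k by ring, show (k : ℂ) + 2 - 2 = k by ring]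
  field_simp
  ring

/-- The bracket `cos s + sin² s log (cot (s / 2))`. -/
noncomputable def logBracket (s : ℝ) : ℝ :=
  Real.cos s + Real.sin s ^ 2 * Real.log (Real.cot (s / 2))

/-- The `iπ/2` from the complex logarithm cancels `-k π sin² s` exactly, so only the real logarithm
survives. -/
theorem phaseValue_eq_closed_form {s : ℝ} (hs : s ∈ Set.Ioo 0 Real.pi) {k : ℤ} (hk : Odd k) :
    phaseValue s k =
      -(2 * Complex.I * (k.sign : ℂ) / ((|k| : ℤ) + 2)) * Complex.exp (-(Complex.I * k * s)) -
      2 * Complex.I * k * ((logBracket s : ℂ) + ∑ n ∈ Finset.range ((k.natAbs - 1) / 2 + 1),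
        4 * Complex.exp (-(Complex.I * (k.sign : ℂ) * (2 * n + 1) * s)) /
          ((2 * n - 1) * (2 * n + 1) * (2 * n + 3))) := by
  have hm1 := oddSum_neg_one hs
  have hcases : ∃ m : ℕ, k = 2 * m + 1 ∨ k = -(2 * m + 1) := by
    obtain ⟨j, rfl⟩ := hk
    rcases le_or_gt 0 j with h | h
    · exact ⟨j.toNat, Or.inl (by omega)⟩
    · exact ⟨(-j - 1).toNat, Or.inr (by omega)⟩
  have hlb : (logBracket s : ℂ) = (Real.cos s : ℂ) +
      (Real.sin s : ℂ) ^ 2 * (Real.log (Real.cot (s / 2)) : ℂ) := by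
    rw [logBracket]; push_cast; rfl
  obtain ⟨m, rfl | rfl⟩ := hcases
  · have hsum : ∑ n ∈ Finset.range (m + 1), oddTerm s (-(2 * n + 1)) =
        -(1 / 4) * ∑ n ∈ Finset.range (m + 1),
          4 * Complex.exp (-(Complex.I * ((1 : ℤ) : ℂ) * (2 * n + 1) * s)) /
            ((2 * n - 1) * (2 * n + 1) * (2 * n + 3)) := by
      rw [Finset.mul_sum]
      refine Finset.sum_congr rfl fun n _ => ?_
      rw [oddTerm_neg]
      push_cast
      ring_nf
    have e1 : (2 * (m : ℤ) + 1).sign = 1 := Int.sign_eq_one_of_pos (by omega)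
    have e2 : ((2 * (m : ℤ) + 1).natAbs - 1) / 2 + 1 = m + 1 := by omega
    have e3 : |2 * (m : ℤ) + 1| = 2 * m + 1 := abs_of_pos (by omega)
    rw [phaseValue, oddSum_of_pos, hm1, hsum, e1, e2, e3, hlb, Int.cast_one]
    linear_combination (-(((2 * m + 1 : ℤ) : ℂ)) * Real.pi * (Real.sin s : ℂ) ^ 2) * Complex.I_sq
  · have hsum : ∑ n ∈ Finset.range m, oddTerm s (2 * n + 1) =
        (1 / 4) * ∑ n ∈ Finset.range m,
          4 * Complex.exp (-(Complex.I * ((-1 : ℤ) : ℂ) * (2 * n + 1) * s)) /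
            ((2 * n - 1) * (2 * n + 1) * (2 * n + 3)) := by
      rw [Finset.mul_sum]
      refine Finset.sum_congr rfl fun n _ => ?_
      rw [oddTerm]
      push_cast
      ring_nf
    have ho : Odd (2 * (m : ℤ) + 1) := ⟨m, rfl⟩
    have a1 := Odd.cast_ne_zero ho
    have a2 := Odd.cast_add_two_ne_zero ho
    have a3 := Odd.cast_sub_two_ne_zero ho
    have e1 : (-(2 * (m : ℤ) + 1)).sign = -1 := Int.sign_eq_neg_one_of_neg (by omega)
    have e2 : ((-(2 * (m : ℤ) + 1)).natAbs - 1) / 2 + 1 = m + 1 := by omega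
    have e3 : |-(2 * (m : ℤ) + 1)| = 2 * m + 1 := by rw [abs_neg]; exact abs_of_pos (by omega)
    have e4 : Complex.exp (-(Complex.I * ((-1 : ℤ) : ℂ) * (2 * m + 1) * s)) =
        Complex.exp (-(Complex.I * ((-(2 * m + 1) : ℤ) : ℂ) * s)) := by
      push_cast; ring_nf
    rw [phaseValue, oddSum_of_neg, hm1, hsum, e1, e2, e3, hlb, Finset.sum_range_succ, e4]
    generalize Complex.exp (-(Complex.I * ((-(2 * m + 1) : ℤ) : ℂ) * s)) = E
    generalize ∑ n ∈ Finset.range m, 4 * Complex.exp (-(Complex.I * ((-1 : ℤ) : ℂ) * (2 * n + 1) * s)) /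
            ((2 * n - 1) * (2 * n + 1) * (2 * n + 3)) = T
    -- For `k = -(2m + 1)` the sum supplies only `m` terms; the missing last one accounts for
    -- replacing `1/(k + 2)` by `sgn k / (|k| + 2)`.
    have key : -(2 * Complex.I / (-(2 * (m : ℂ) + 1) + 2)) * E =
        2 * Complex.I / (2 * m + 1 + 2) * E + 2 * Complex.I * (2 * m + 1) *
          (4 * E / ((2 * m - 1) * (2 * m + 1) * (2 * m + 3))) := by
      push_cast at a1 a2 a3
      have b1 : (2 * (m : ℂ) - 1) ≠ 0 := by
        intro h; apply a3; linear_combination h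
      have b2 : (2 * (m : ℂ) + 3) ≠ 0 := by
        intro h; apply a2; linear_combination h
      rw [show (-(2 * (m : ℂ) + 1) + 2) = -(2 * m - 1) by ring,
        show (2 * (m : ℂ) + 1 + 2) = 2 * m + 3 by ring]
      field_simp
      ring
    push_cast [-Complex.ofReal_sin]
    linear_combination key +
      ((2 * (m : ℂ) + 1) * Real.pi * (Real.sin s : ℂ) ^ 2) * Complex.I_sq

theorem hasPV_phaseIntegrand (x : ℝ) {k : ℤ} (hk : Odd k) :
    HasPV (phaseIntegrand k x) (phaseValue (acot x) k) := by
  have hs : acot x ∈ Set.Ioo 0 Real.pi := ⟨acot_pos x, acot_lt_pi x⟩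
  have hp : (Real.sin (acot x) : ℂ) ^ 2 + (Real.cos (acot x) : ℂ) ^ 2 = 1 := by
    exact_mod_cast Real.sin_sq_add_cos_sq (acot x)
  refine hasPV_phaseIntegrand_of_recurrence x ?_ ?_ (fun k hk => phaseValue_recurrence _ hk) hk
  · rw [phaseValue_eq_closed_form hs (by decide), logBracket,
      show -(Complex.I * ((1 : ℤ) : ℂ) * acot x) = ((-acot x : ℝ) : ℂ) * Complex.I by push_cast; ring,
      Complex.exp_mul_I]
    simp only [Int.sign_one, Int.natAbs_one, Finset.sum_range_one, Nat.sub_self, Nat.zero_div,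
      zero_add, abs_one, Int.cast_one]
    rw [show -(Complex.I * 1 * (2 * ((0 : ℕ) : ℂ) + 1) * acot x) = ((-acot x : ℝ) : ℂ) * Complex.I by
      push_cast; ring, Complex.exp_mul_I, ← Complex.ofReal_cos, ← Complex.ofReal_sin, Real.cos_neg,
      Real.sin_neg]
    push_cast [-Complex.ofReal_sin, -Complex.ofReal_cos]
    norm_num
    linear_combination (-2 * (Complex.sin (acot x) : ℂ)) * Complex.I_sq
  · rw [phaseValue_eq_closed_form hs (by decide), logBracket,
      show -(Complex.I * ((-1 : ℤ) : ℂ) * acot x) = ((acot x : ℝ) : ℂ) * Complex.I by push_cast; ring,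
      Complex.exp_mul_I]
    have e2 : ((-1 : ℤ).natAbs - 1) / 2 + 1 = 1 := by decide
    have e1 : (-1 : ℤ).sign = -1 := by decide
    rw [e1, e2, Finset.sum_range_one]
    rw [show -(Complex.I * ((-1 : ℤ) : ℂ) * (2 * ((0 : ℕ) : ℂ) + 1) * acot x) =
      ((acot x : ℝ) : ℂ) * Complex.I by push_cast; ring, Complex.exp_mul_I, ← Complex.ofReal_cos,
      ← Complex.ofReal_sin]
    push_cast [-Complex.ofReal_sin, -Complex.ofReal_cos]
    norm_num
    linear_combination (-2 * (Complex.sin (acot x) : ℂ)) * Complex.I_sq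

/-! ### From the principal value to the half Laplacian -/

theorem fracLapConst_one : fracLapConst 1 = 1 / Real.pi := by
  have h1 : (1 / 2 + 1 / 2 : ℝ) = 1 := by norm_num
  have h2 : (1 - 1 / 2 : ℝ) = 1 / 2 := by norm_num
  rw [fracLapConst, h1, h2, Real.Gamma_one, Real.Gamma_one_half_eq, sub_self, Real.rpow_zero,
    Real.mul_self_sqrt Real.pi_pos.le]
  norm_num

theorem hasHalfLaplacianAt_exp_acot {k : ℤ} {L : ℝ} (hL : 0 < L) {x : ℝ} {V v : ℂ}
    (h : HasPV (phaseIntegrand k (x / L)) V)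
    (hv : v = Complex.exp (Complex.I * k * acot (x / L)) * V / (L * Real.pi)) :
    HasHalfLaplacianAt (fun y : ℝ => Complex.exp (Complex.I * k * acot (y / L))) x v := by
  have hL' : (L : ℂ) ≠ 0 := by exact_mod_cast hL.ne'
  have hpi : (Real.pi : ℂ) ≠ 0 := by exact_mod_cast Real.pi_ne_zero
  have key : HasPV (fracLapIntegrand 1
      (fun y : ℝ => Complex.exp (Complex.I * k * acot (y / L))) x)
      (Complex.exp (Complex.I * k * acot (x / L)) / L ^ 2 * (L * V)) := by
    refine ((h.comp_div hL).const_mul _).congr (fun y hy => ?_) rfl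
    have hexp : Complex.exp (Complex.I * k * acot ((x + y) / L)) =
        Complex.exp (Complex.I * k * acot (x / L)) *
          Complex.exp (Complex.I * k * acotDiff (x / L) (y / L)) := by
      rw [← Complex.exp_add, acotDiff, add_div]
      push_cast
      ring_nf
    have hpow : |y| ^ (1 + 1 : ℝ) = y ^ 2 := by
      rw [show (1 + 1 : ℝ) = ((2 : ℕ) : ℝ) by norm_num, Real.rpow_natCast, sq_abs]
    have hy' : (y : ℂ) ≠ 0 := by exact_mod_cast hy
    rw [fracLapIntegrand, hpow, phaseIntegrand, hexp]
    push_cast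
    field_simp
  refine ⟨key.1, ?_⟩
  have := key.2.const_mul ((fracLapConst 1 : ℝ) : ℂ)
  convert this using 2
  rw [hv, fracLapConst_one]
  push_cast
  field_simp

/-! ### Algebraic forms in the variable `x` -/

theorem add_I_eq (y : ℝ) : (y : ℂ) + Complex.I =
    (√(y ^ 2 + 1) : ℂ) * Complex.exp (Complex.I * acot y) := by
  have h : (√(1 + y ^ 2) : ℂ) ≠ 0 := by
    have : √(1 + y ^ 2) ≠ 0 := by positivity
    exact_mod_cast this
  rw [mul_comm Complex.I, Complex.exp_mul_I, ← Complex.ofReal_cos, ← Complex.ofReal_sin, sin_acot,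
    cos_acot, add_comm (y ^ 2)]
  push_cast
  field_simp

theorem add_I_zpow_div_rpow (y : ℝ) (j : ℤ) :
    ((y : ℂ) + Complex.I) ^ j / (((y ^ 2 + 1) ^ ((j : ℝ) / 2) : ℝ) : ℂ) =
      Complex.exp (Complex.I * j * acot y) := by
  have hpos : 0 < y ^ 2 + 1 := by positivity
  have h : (√(y ^ 2 + 1) : ℂ) ≠ 0 := by
    have : √(y ^ 2 + 1) ≠ 0 := by positivity
    exact_mod_cast this
  have hr : (y ^ 2 + 1) ^ ((j : ℝ) / 2) = √(y ^ 2 + 1) ^ j := by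
    rw [Real.sqrt_eq_rpow, ← Real.rpow_intCast, ← Real.rpow_mul hpos.le]
    ring_nf
  rw [add_I_eq, mul_zpow, hr, Complex.ofReal_zpow, mul_div_cancel_left₀ _ (zpow_ne_zero _ h),
    ← Complex.exp_int_mul]
  ring_nf

theorem add_I_zpow_div_rpow_add_one (y : ℝ) (j : ℤ) :
    ((y : ℂ) + Complex.I) ^ j / (((y ^ 2 + 1) ^ ((j : ℝ) / 2 + 1) : ℝ) : ℂ) =
      Complex.exp (Complex.I * j * acot y) * (Real.sin (acot y) : ℂ) ^ 2 := by
  have hpos : 0 < y ^ 2 + 1 := by positivity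
  rw [Real.rpow_add_one hpos.ne', Complex.ofReal_mul, ← div_div, add_I_zpow_div_rpow,
    ← Complex.ofReal_pow, sin_acot_sq, add_comm (1 : ℝ), Complex.ofReal_div, Complex.ofReal_one,
    mul_one_div]

theorem add_I_sq_div (x : ℝ) : ((x : ℂ) + Complex.I) ^ 2 / ((x : ℂ) ^ 2 + 1) =
    Complex.exp (2 * Complex.I * acot x) := by
  have h := add_I_zpow_div_rpow x 2
  rw [show (((2 : ℤ) : ℝ) / 2) = 1 by norm_num, Real.rpow_one] at h
  push_cast at h
  rw [mul_comm 2 Complex.I, ← h]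
  norm_cast

/-- Here `cot (s/2) = x + √(1 + x²)`, whose logarithm is `arsinh x`, while `sin² s = 1/(1 + x²)`. -/
theorem logBracket_acot (x : ℝ) :
    x * √(x ^ 2 + 1) + Real.arsinh x = (x ^ 2 + 1) * logBracket (acot x) := by
  have hr : 0 < √(1 + x ^ 2) := by positivity
  have hsq : √(1 + x ^ 2) ^ 2 = 1 + x ^ 2 := Real.sq_sqrt (by positivity)
  have hs0 := acot_pos x
  have hsp := acot_lt_pi x
  have hsn : 0 < Real.sin (acot x / 2) := Real.sin_pos_of_pos_of_lt_pi (by linarith) (by linarith)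
  have hc : 0 < Real.cos (acot x / 2) := Real.cos_pos_of_mem_Ioo ⟨by linarith, by linarith⟩
  have h1 : Real.sin (acot x) = 2 * Real.sin (acot x / 2) * Real.cos (acot x / 2) := by
    rw [← Real.sin_two_mul]; ring_nf
  have h2 : Real.cos (acot x) = 2 * Real.cos (acot x / 2) ^ 2 - 1 := by
    rw [← Real.cos_two_mul]; ring_nf
  have hcot : Real.cot (acot x / 2) = x + √(1 + x ^ 2) := by
    have h3 : Real.cot (acot x / 2) = (1 + Real.cos (acot x)) / Real.sin (acot x) := by
      rw [h1, h2, Real.cot_eq_cos_div_sin]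
      field_simp
      ring
    rw [h3, sin_acot, cos_acot]
    field_simp
    ring
  rw [logBracket, hcot, Real.arsinh, sin_acot_sq, cos_acot, add_comm (x ^ 2)]
  have h4 : (1 + x ^ 2) * (x / √(1 + x ^ 2)) = x * √(1 + x ^ 2) := by
    rw [← mul_div_assoc, div_eq_iff hr.ne']
    linear_combination -x * hsq
  rw [mul_add, h4]
  field_simp

theorem hasHalfLaplacianAt_series {k : ℤ} (hk : Odd k) {L : ℝ} (hL : 0 < L) {s x : ℝ}
    (hs : s = acot (x / L)) :
    HasHalfLaplacianAt (fun y : ℝ => Complex.exp (Complex.I * k * acot (y / L))) x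
      (-(2 * Complex.I / (L * Real.pi * (k + 2)))
        - k / L * Complex.sin s ^ 2 * Complex.exp (Complex.I * k * s)
        + 8 * Complex.I * ordinaryHypergeometric (1 : ℂ) (-(k : ℂ) / 2 - 1) (-(k : ℂ) / 2 + 2)
            (Complex.exp (2 * Complex.I * s)) / (L * Real.pi * (4 - (k : ℂ) ^ 2))) := by
  refine hasHalfLaplacianAt_exp_acot hL (hasPV_phaseIntegrand (x / L) hk) ?_
  have hL' : (L : ℂ) ≠ 0 := by exact_mod_cast hL.ne'
  have hpi : (Real.pi : ℂ) ≠ 0 := by exact_mod_cast Real.pi_ne_zero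
  have a1 := Odd.cast_add_two_ne_zero hk
  have a2 := Odd.cast_sub_two_ne_zero hk
  have a3 : 4 - (k : ℂ) ^ 2 ≠ 0 := by
    rw [show 4 - (k : ℂ) ^ 2 = -((k + 2) * (k - 2)) by ring]
    exact neg_ne_zero.2 (mul_ne_zero a1 a2)
  rw [← hs, ordinaryHypergeometric_eq_oddSum hk, phaseValue, Complex.exp_neg, Complex.ofReal_sin]
  have hE := Complex.exp_ne_zero (Complex.I * k * s)
  field_simp

theorem hasHalfLaplacianAt_closed_form {k : ℤ} (hk : Odd k) {L : ℝ} (hL : 0 < L) {s x : ℝ}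
    (hs : s = acot (x / L)) :
    HasHalfLaplacianAt (fun y : ℝ => Complex.exp (Complex.I * k * acot (y / L))) x
      (-(2 * Complex.I * (k.sign : ℂ) / (L * Real.pi * ((|k| : ℤ) + 2)))
        - 2 * Complex.I * k / (L * Real.pi) * Complex.exp (Complex.I * k * s) *
          (((Real.cos s + Real.sin s ^ 2 * Real.log (Real.cot (s / 2)) : ℝ) : ℂ)
            + ∑ n ∈ Finset.range ((k.natAbs - 1) / 2 + 1),
                4 * Complex.exp (-(Complex.I * (k.sign : ℂ) * (2 * n + 1) * s)) /
                  ((2 * n - 1) * (2 * n + 1) * (2 * n + 3)))) := by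
  refine hasHalfLaplacianAt_exp_acot hL (hasPV_phaseIntegrand (x / L) hk) ?_
  have hL' : (L : ℂ) ≠ 0 := by exact_mod_cast hL.ne'
  have hpi : (Real.pi : ℂ) ≠ 0 := by exact_mod_cast Real.pi_ne_zero
  have a1 : ((|k| : ℤ) : ℂ) + 2 ≠ 0 := by
    have : |k| + 2 ≠ 0 := by positivity
    exact_mod_cast this
  have hmem : s ∈ Set.Ioo 0 Real.pi := hs ▸ ⟨acot_pos _, acot_lt_pi _⟩
  rw [← hs, phaseValue_eq_closed_form hmem hk, Complex.exp_neg, ← logBracket]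
  have hE := Complex.exp_ne_zero (Complex.I * k * s)
  generalize ∑ n ∈ Finset.range ((k.natAbs - 1) / 2 + 1),
    4 * Complex.exp (-(Complex.I * (k.sign : ℂ) * (2 * n + 1) * s)) /
      ((2 * n - 1) * (2 * n + 1) * (2 * n + 3)) = T
  field_simp

end HalfLap

theorem theorem1 (k : ℤ) (hk : Odd k) :
    (∀ L : ℝ, 0 < L → ∀ s : ℝ, s ∈ Set.Ioo 0 Real.pi → ∀ x : ℝ,
      (x = L * Real.cot s ↔ s = HalfLap.acot (x / L)) ∧
      (x = L * Real.cot s →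
        Summable (HalfLap.hypTerm k (Complex.exp (2 * Complex.I * s))) ∧
        HalfLap.HasHalfLaplacianAt
          (fun y : ℝ => Complex.exp (Complex.I * k * HalfLap.acot (y / L))) x
          (-(2 * Complex.I / (L * Real.pi * (k + 2)))
            - k / L * Complex.sin s ^ 2 * Complex.exp (Complex.I * k * s)
            + 8 * Complex.I * ordinaryHypergeometric (1 : ℂ) (-(k : ℂ) / 2 - 1) (-(k : ℂ) / 2 + 2)
                (Complex.exp (2 * Complex.I * s)) / (L * Real.pi * (4 - (k : ℂ) ^ 2))) ∧
        HalfLap.HasHalfLaplacianAt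
          (fun y : ℝ => Complex.exp (Complex.I * k * HalfLap.acot (y / L))) x
          (-(2 * Complex.I * (k.sign : ℂ) / (L * Real.pi * ((|k| : ℤ) + 2)))
            - 2 * Complex.I * k / (L * Real.pi) * Complex.exp (Complex.I * k * s) *
              (((Real.cos s + Real.sin s ^ 2 * Real.log (Real.cot (s / 2)) : ℝ) : ℂ)
                + ∑ n ∈ Finset.range ((k.natAbs - 1) / 2 + 1),
                    4 * Complex.exp (-(Complex.I * (k.sign : ℂ) * (2 * n + 1) * s)) /
                      ((2 * n - 1) * (2 * n + 1) * (2 * n + 3)))))) ∧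
    (∀ x : ℝ,
      Summable (HalfLap.hypTerm k (((x : ℂ) + Complex.I) ^ 2 / ((x : ℂ) ^ 2 + 1))) ∧
      HalfLap.HasHalfLaplacianAt
        (fun y : ℝ => ((y : ℂ) + Complex.I) ^ k / (((y ^ 2 + 1) ^ ((k : ℝ) / 2) : ℝ) : ℂ)) x
        (-(2 * Complex.I / (Real.pi * (k + 2)))
          - k * ((x : ℂ) + Complex.I) ^ k / (((x ^ 2 + 1) ^ ((k : ℝ) / 2 + 1) : ℝ) : ℂ)
          + 8 * Complex.I / (Real.pi * (4 - (k : ℂ) ^ 2)) *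
              ordinaryHypergeometric (1 : ℂ) (-(k : ℂ) / 2 - 1) (-(k : ℂ) / 2 + 2)
                (((x : ℂ) + Complex.I) ^ 2 / ((x : ℂ) ^ 2 + 1))) ∧
      HalfLap.HasHalfLaplacianAt
        (fun y : ℝ => ((y : ℂ) + Complex.I) ^ k / (((y ^ 2 + 1) ^ ((k : ℝ) / 2) : ℝ) : ℂ)) x
        (-(2 * Complex.I * (k.sign : ℂ) / (Real.pi * ((|k| : ℤ) + 2)))
          - 2 * Complex.I * k * ((x : ℂ) + Complex.I) ^ k *
              ((x * Real.sqrt (x ^ 2 + 1) + Real.arsinh x : ℝ) : ℂ) /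
              (Real.pi * (((x ^ 2 + 1) ^ ((k : ℝ) / 2 + 1) : ℝ) : ℂ))
          - ∑ n ∈ Finset.range ((k.natAbs - 1) / 2 + 1),
              8 * Complex.I * k * ((x : ℂ) + Complex.I) ^ (k - k.sign * (2 * (n : ℤ) + 1)) /
                (Real.pi * (2 * n - 1) * (2 * n + 1) * (2 * n + 3) *
                  (((x ^ 2 + 1) ^ (((k - k.sign * (2 * (n : ℤ) + 1) : ℤ) : ℝ) / 2) : ℝ) : ℂ)))) := by

  -- By the polar form of `y + i`, the algebraic function is the exponential one with `L = 1`.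
  have hfun : (fun y : ℝ => ((y : ℂ) + Complex.I) ^ k / (((y ^ 2 + 1) ^ ((k : ℝ) / 2) : ℝ) : ℂ)) =
      fun y : ℝ => Complex.exp (Complex.I * k * HalfLap.acot (y / 1)) := by
    funext y
    rw [HalfLap.add_I_zpow_div_rpow, div_one]
  refine ⟨fun L hL s hs x => ?_, fun x => ?_⟩
  · have hiff : x = L * Real.cot s ↔ s = HalfLap.acot (x / L) := by
      constructor
      · rintro rfl
        rw [mul_div_cancel_left₀ _ hL.ne', HalfLap.acot_cot hs]
      · rintro rfl
        rw [HalfLap.cot_acot, mul_div_cancel₀ _ hL.ne']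
    exact ⟨hiff, fun hx => ⟨HalfLap.summable_hypTerm hk s,
      HalfLap.hasHalfLaplacianAt_series hk hL (hiff.1 hx),
      HalfLap.hasHalfLaplacianAt_closed_form hk hL (hiff.1 hx)⟩⟩
  · have hs : HalfLap.acot x = HalfLap.acot (x / 1) := by rw [div_one]
    rw [hfun, HalfLap.add_I_sq_div]
    refine ⟨HalfLap.summable_hypTerm hk _, ?_, ?_⟩
    · convert HalfLap.hasHalfLaplacianAt_series hk one_pos hs using 1
      rw [mul_div_assoc (k : ℂ), HalfLap.add_I_zpow_div_rpow_add_one, Complex.ofReal_one,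
        Complex.ofReal_sin]
      ring
    · convert HalfLap.hasHalfLaplacianAt_closed_form hk one_pos hs using 1
      have hx : ((x ^ 2 + 1 : ℝ) : ℂ) ≠ 0 := by
        have : x ^ 2 + 1 ≠ 0 := by positivity
        exact_mod_cast this
      have hmid : ((x : ℂ) + Complex.I) ^ k *
          ((x * Real.sqrt (x ^ 2 + 1) + Real.arsinh x : ℝ) : ℂ) /
            (((x ^ 2 + 1) ^ ((k : ℝ) / 2 + 1) : ℝ) : ℂ) =
          Complex.exp (Complex.I * k * HalfLap.acot x) * (HalfLap.logBracket (HalfLap.acot x) : ℂ) := by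
        rw [mul_div_right_comm, Real.rpow_add_one (by positivity), Complex.ofReal_mul, ← div_div,
          HalfLap.add_I_zpow_div_rpow, HalfLap.logBracket_acot, Complex.ofReal_mul]
        field_simp
      have hsum : ∀ n : ℕ, 8 * Complex.I * k *
          ((x : ℂ) + Complex.I) ^ (k - k.sign * (2 * (n : ℤ) + 1)) /
            (Real.pi * (2 * n - 1) * (2 * n + 1) * (2 * n + 3) *
              (((x ^ 2 + 1) ^ (((k - k.sign * (2 * (n : ℤ) + 1) : ℤ) : ℝ) / 2) : ℝ) : ℂ)) =
          2 * Complex.I * k / Real.pi * Complex.exp (Complex.I * k * HalfLap.acot x) *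
            (4 * Complex.exp (-(Complex.I * (k.sign : ℂ) * (2 * n + 1) * HalfLap.acot x)) /
              ((2 * n - 1) * (2 * n + 1) * (2 * n + 3))) := by
        intro n
        rw [mul_div_mul_comm]
        have := HalfLap.add_I_zpow_div_rpow x (k - k.sign * (2 * (n : ℤ) + 1))
        have e : Complex.exp (Complex.I * ((k - k.sign * (2 * (n : ℤ) + 1) : ℤ) : ℂ) * HalfLap.acot x) =
            Complex.exp (Complex.I * k * HalfLap.acot x) *
              Complex.exp (-(Complex.I * (k.sign : ℂ) * (2 * n + 1) * HalfLap.acot x)) := by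
          rw [← Complex.exp_add]
          push_cast
          ring_nf
        rw [e] at this
        rw [this, mul_assoc (Real.pi : ℂ), mul_assoc (Real.pi : ℂ)]
        generalize (2 * (n : ℂ) - 1) * (2 * n + 1) * (2 * n + 3) = D
        ring
      rw [Finset.sum_congr rfl fun n _ => hsum n, ← Finset.mul_sum, ← HalfLap.logBracket,
        Complex.ofReal_one]
      linear_combination (-(2 * Complex.I * k / Real.pi)) * hmid
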